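/- Let $\mathcal X_0,\mathcal X_1,\mathcal X_2$ be finite alphabets and let $(X_0,X_1,X_2)$ have joint probability mass function $p$ on $\mathcal X_0\times\mathcal X_1\times\mathcal X_2$. Let $(X_{0,t},X_{1,t},X_{2,t})_{t\ge 1}$ be i.i.d. copies. In the 2-sink, 1-helper network, source node $E_i$ observes $X_i^n$ ($i=0,1,2$). A code of length $n$ with index-set sizes $L_{0,12},L_{0,1},L_{0,2},L_1,L_2$ (positive integers) consists of encoders $$f_0:\mathcal X_0^n\to I_{L_{0,12}}\times I_{L_{0,1}}\times I_{L_{0,2}},\qquad f_1:\mathcal X_1^n\to I_{L_1},\qquad f_2:\mathcal X_2^n\to I_{L_2},$$ where $I_L=\{1,\dots,L\}$, producing indices $(T_{0,12},T_{0,1},T_{0,2}),T_1,T_2$, and of decoders $g_1:I_{L_{0,12}}\times I_{L_{0,1}}\times I_{L_1}\to\mathcal X_1^n$ at sink $S_1$ and $g_2:I_{L_{0,12}}\times I_{L_{0,2}}\times I_{L_2}\to\mathcal X_2^n$ at sink $S_2$. Its error probability is $$P_e=\tfrac12\bigl[P\bigl(X_1^n\ne g_1(T_{0,12},T_{0,1},T_1)\bigr)+P\bigl(X_2^n\ne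 g_2(T_{0,12},T_{0,2},T_2)\bigr)\bigr].$$ A rate tuple $(R_{0,12},R_{0,1},R_{0,2},R_1,R_2)\in\mathbb R^5$ is achievable if for every $\eta>0$ and $0<\epsilon<1$ there is, for all sufficiently large $n$, a code of length $n$ with $P_e<\epsilon$ and $\frac1n\log_2 L_k\le R_k+\eta$ for each of the five packets $k$. The complete rate region is the set of all achievable rate tuples. Let $(U_0,U_1,U_2)$ be random variables with values in arbitrary finite sets $\mathcal U_0,\mathcal U_1,\mathcal U_2$, jointly distributed with $(X_0,X_1,X_2)$ such that the Markov chains $$X_1\leftrightarrow X_0\leftrightarrow(U_0,U_1,U_2),\qquad X_2\leftrightarrow X_0\leftrightarrow(U_0,U_1,U_2)$$ hold. Then every rate tuple satisfying $$R_{0,12}\ge I(X_0;U_0),\quad R_{0,1}\ge I(X_0;U_1|U_0),\quad R_{0,2}\ge I(X_0;U_2|U_0),$$ $$R_1\ge H(X_1|U_0,U_1),\quad R_2\ge H(X_2|U_0,U_2)$$ is achievable (entropies and informations in bits). Moreover, the complete rate region equals the closure in $\mathbb R^5$ of the union, over all such $(U_0,U_1,U_2)$, of the sets of rate tuples satisfying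 these five inequalities. -/

import Mathlib

namespace HelperDIR

/-! ### Finite probability: laws, Markov chains and information measures (in bits)

A finite probability space is a finite type `Ω` with a mass function `q ∈ stdSimplex ℝ Ω`;
a random variable is a function on `Ω`. -/

section Information

variable {Ω A B C : Type*} [Fintype Ω]

open Classical in
/-- The probability `P(X = a)` under the mass function `q`. -/
noncomputable def law (q : Ω → ℝ) (X : Ω → A) (a : A) : ℝ :=
  ∑ ω, if X ω = a then q ω else 0

/-- The Markov chain `X ↔ Y ↔ Z`: `p(x,y,z) p(y) = p(x,y) p(y,z)` for all `x, y, z`. -/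
def IsMarkovChain (q : Ω → ℝ) (X : Ω → A) (Y : Ω → B) (Z : Ω → C) : Prop :=
  ∀ x y z, law q (fun ω => (X ω, Y ω, Z ω)) (x, y, z) * law q Y y =
    law q (fun ω => (X ω, Y ω)) (x, y) * law q (fun ω => (Y ω, Z ω)) (y, z)

variable [Fintype A] [Fintype B] [Fintype C]

/-- Conditional entropy `H(X | Y) = - ∑ p(x,y) log₂ p(x|y)`. Terms with `p(x,y) = 0` vanish. -/
noncomputable def condEntropy (q : Ω → ℝ) (X : Ω → A) (Y : Ω → B) : ℝ :=
  -∑ x, ∑ y, law q (fun ω => (X ω, Y ω)) (x, y) *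
    Real.logb 2 (law q (fun ω => (X ω, Y ω)) (x, y) / law q Y y)

/-- Mutual information `I(X; Y) = ∑ p(x,y) log₂ (p(x,y) / (p(x) p(y)))`. -/
noncomputable def mutualInfo (q : Ω → ℝ) (X : Ω → A) (Y : Ω → B) : ℝ :=
  ∑ x, ∑ y, law q (fun ω => (X ω, Y ω)) (x, y) *
    Real.logb 2 (law q (fun ω => (X ω, Y ω)) (x, y) / (law q X x * law q Y y))

/-- Conditional mutual information
`I(X; Y | Z) = ∑ p(x,y,z) log₂ (p(x,y|z) / (p(x|z) p(y|z)))`. -/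
noncomputable def condMutualInfo (q : Ω → ℝ) (X : Ω → A) (Y : Ω → B) (Z : Ω → C) : ℝ :=
  ∑ x, ∑ y, ∑ z, law q (fun ω => (X ω, Y ω, Z ω)) (x, y, z) *
    Real.logb 2 ((law q (fun ω => (X ω, Y ω, Z ω)) (x, y, z) / law q Z z) /
      ((law q (fun ω => (X ω, Z ω)) (x, z) / law q Z z) *
        (law q (fun ω => (Y ω, Z ω)) (y, z) / law q Z z)))

end Information

/-! ### The network: codes and achievable rates -/

/-- The five packets. `p012`, `p01`, `p02` go from `E₀` to both sinks, to `S₁` only and to `S₂`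
only; `p1` goes from `E₁` to `S₁` and `p2` from `E₂` to `S₂`. -/
inductive Packet
  | p012
  | p01
  | p02
  | p1
  | p2

section Codes

variable {𝒳₀ 𝒳₁ 𝒳₂ : Type*}

/-- A block code of length `n`. Packet `k` carries an index from a set with `L k` elements
(`L k` is positive as soon as the alphabets are nonempty, since the encoders are total). -/
structure Code (n : ℕ) (𝒳₀ 𝒳₁ 𝒳₂ : Type*) where
  /-- sizes of the index sets -/
  L : Packet → ℕ
  /-- encoder at `E₀` -/
  enc₀ : (Fin n → 𝒳₀) → Fin (L .p012) × Fin (L .p01) × Fin (L .p02)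
  /-- encoder at `E₁` -/
  enc₁ : (Fin n → 𝒳₁) → Fin (L .p1)
  /-- encoder at `E₂` -/
  enc₂ : (Fin n → 𝒳₂) → Fin (L .p2)
  /-- decoder at `S₁`, which receives the packets `p012`, `p01`, `p1` -/
  dec₁ : Fin (L .p012) × Fin (L .p01) × Fin (L .p1) → (Fin n → 𝒳₁)
  /-- decoder at `S₂`, which receives the packets `p012`, `p02`, `p2` -/
  dec₂ : Fin (L .p012) × Fin (L .p02) × Fin (L .p2) → (Fin n → 𝒳₂)

/-- The reconstruction of the `X₁` sequence at `S₁` when the sources emit `x`. -/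
def Code.est₁ {n : ℕ} (c : Code n 𝒳₀ 𝒳₁ 𝒳₂) (x : Fin n → 𝒳₀ × 𝒳₁ × 𝒳₂) : Fin n → 𝒳₁ :=
  let t := c.enc₀ fun i => (x i).1
  c.dec₁ (t.1, t.2.1, c.enc₁ fun i => (x i).2.1)

/-- The reconstruction of the `X₂` sequence at `S₂` when the sources emit `x`. -/
def Code.est₂ {n : ℕ} (c : Code n 𝒳₀ 𝒳₁ 𝒳₂) (x : Fin n → 𝒳₀ × 𝒳₁ × 𝒳₂) : Fin n → 𝒳₂ :=
  let t := c.enc₀ fun i => (x i).1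
  c.dec₂ (t.1, t.2.2, c.enc₂ fun i => (x i).2.2)

variable [Fintype 𝒳₀] [Fintype 𝒳₁] [Fintype 𝒳₂]

open Classical in
/-- The probability of error, averaged over the two sinks, when the triples
`(X₀, X₁, X₂)` are i.i.d. with mass function `p`. -/
noncomputable def Code.errorProb {n : ℕ} (c : Code n 𝒳₀ 𝒳₁ 𝒳₂) (p : 𝒳₀ × 𝒳₁ × 𝒳₂ → ℝ) : ℝ :=
  (1 / 2) *
    ((∑ x : Fin n → 𝒳₀ × 𝒳₁ × 𝒳₂,
        if (fun i => (x i).2.1) ≠ c.est₁ x then ∏ i, p (x i) else 0) +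
      ∑ x : Fin n → 𝒳₀ × 𝒳₁ × 𝒳₂,
        if (fun i => (x i).2.2) ≠ c.est₂ x then ∏ i, p (x i) else 0)

/-- The rate tuple `R` is achievable: for all `η > 0` and `0 < ε < 1` and all sufficiently large
`n` there is a code of length `n` whose rates exceed those of `R` by at most `η`, with error
probability less than `ε`. -/
def Achievable (p : 𝒳₀ × 𝒳₁ × 𝒳₂ → ℝ) (R : Packet → ℝ) : Prop :=
  ∀ η : ℝ, 0 < η → ∀ ε : ℝ, 0 < ε → ε < 1 → ∀ᶠ n : ℕ in Filter.atTop,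
    ∃ c : Code n 𝒳₀ 𝒳₁ 𝒳₂,
      (∀ k, (1 / (n : ℝ)) * Real.logb 2 (c.L k) ≤ R k + η) ∧ c.errorProb p < ε

/-- The complete rate region: all achievable rate tuples. -/
def rateRegion (p : 𝒳₀ × 𝒳₁ × 𝒳₂ → ℝ) : Set (Packet → ℝ) :=
  {R | Achievable p R}

end Codes

/-! ### The single-letter region -/

section Region

variable {𝒳₀ 𝒳₁ 𝒳₂ 𝒰₀ 𝒰₁ 𝒰₂ : Type*} [Fintype 𝒳₀] [Fintype 𝒳₁] [Fintype 𝒳₂]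
  [Fintype 𝒰₀] [Fintype 𝒰₁] [Fintype 𝒰₂]

/-- `q` is a joint mass function of `((X₀, X₁, X₂), (U₀, U₁, U₂))` such that `(X₀, X₁, X₂)` has
mass function `p`, and `X₁ ↔ X₀ ↔ (U₀, U₁, U₂)` and `X₂ ↔ X₀ ↔ (U₀, U₁, U₂)`. -/
def IsAuxiliary (p : 𝒳₀ × 𝒳₁ × 𝒳₂ → ℝ)
    (q : (𝒳₀ × 𝒳₁ × 𝒳₂) × (𝒰₀ × 𝒰₁ × 𝒰₂) → ℝ) : Prop :=
  q ∈ stdSimplex ℝ ((𝒳₀ × 𝒳₁ × 𝒳₂) × (𝒰₀ × 𝒰₁ × 𝒰₂)) ∧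
    (∀ x, ∑ u, q (x, u) = p x) ∧
    IsMarkovChain q (fun ω => ω.1.2.1) (fun ω => ω.1.1) (fun ω => ω.2) ∧
    IsMarkovChain q (fun ω => ω.1.2.2) (fun ω => ω.1.1) (fun ω => ω.2)

/-- The rate tuples that satisfy the five information constraints for the joint law `q` of
`((X₀, X₁, X₂), (U₀, U₁, U₂))`. -/
def infoRegion (q : (𝒳₀ × 𝒳₁ × 𝒳₂) × (𝒰₀ × 𝒰₁ × 𝒰₂) → ℝ) : Set (Packet → ℝ) :=
  let X₀ : (𝒳₀ × 𝒳₁ × 𝒳₂) × (𝒰₀ × 𝒰₁ × 𝒰₂) → 𝒳₀ := fun ω => ω.1.1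
  let X₁ : (𝒳₀ × 𝒳₁ × 𝒳₂) × (𝒰₀ × 𝒰₁ × 𝒰₂) → 𝒳₁ := fun ω => ω.1.2.1
  let X₂ : (𝒳₀ × 𝒳₁ × 𝒳₂) × (𝒰₀ × 𝒰₁ × 𝒰₂) → 𝒳₂ := fun ω => ω.1.2.2
  let U₀ : (𝒳₀ × 𝒳₁ × 𝒳₂) × (𝒰₀ × 𝒰₁ × 𝒰₂) → 𝒰₀ := fun ω => ω.2.1
  let U₁ : (𝒳₀ × 𝒳₁ × 𝒳₂) × (𝒰₀ × 𝒰₁ × 𝒰₂) → 𝒰₁ := fun ω => ω.2.2.1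
  let U₂ : (𝒳₀ × 𝒳₁ × 𝒳₂) × (𝒰₀ × 𝒰₁ × 𝒰₂) → 𝒰₂ := fun ω => ω.2.2.2
  {R | R .p012 ≥ mutualInfo q X₀ U₀ ∧
    R .p01 ≥ condMutualInfo q X₀ U₁ U₀ ∧
    R .p02 ≥ condMutualInfo q X₀ U₂ U₀ ∧
    R .p1 ≥ condEntropy q X₁ (fun ω => (U₀ ω, U₁ ω)) ∧
    R .p2 ≥ condEntropy q X₂ (fun ω => (U₀ ω, U₂ ω))}

/-- The union of the regions `infoRegion q` over all finite sets `𝒰₀, 𝒰₁, 𝒰₂` and all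
auxiliary joint laws `q`. -/
def infoRegionUnion (p : 𝒳₀ × 𝒳₁ × 𝒳₂ → ℝ) : Set (Packet → ℝ) :=
  {R | ∃ (𝒱₀ 𝒱₁ 𝒱₂ : Type) (_ : Fintype 𝒱₀) (_ : Fintype 𝒱₁) (_ : Fintype 𝒱₂)
    (q : (𝒳₀ × 𝒳₁ × 𝒳₂) × (𝒱₀ × 𝒱₁ × 𝒱₂) → ℝ), IsAuxiliary p q ∧ R ∈ infoRegion q}

end Region

end HelperDIR

namespace HelperDIR

/-! ### Laws and probabilities of events -/

section Law

variable {Ω A B C : Type*} [Fintype Ω]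

open Classical in
/-- The probability of the event `E` under the mass function `q`. -/
noncomputable def prob (q : Ω → ℝ) (E : Ω → Prop) : ℝ :=
  ∑ ω, if E ω then q ω else 0

theorem law_eq_prob (q : Ω → ℝ) (X : Ω → A) (a : A) : law q X a = prob q fun ω => X ω = a :=
  rfl

theorem prob_nonneg {q : Ω → ℝ} (hq : ∀ ω, 0 ≤ q ω) (E : Ω → Prop) : 0 ≤ prob q E :=
  Finset.sum_nonneg fun ω _ => by split_ifs <;> first | exact hq ω | exact le_rfl

theorem prob_congr (q : Ω → ℝ) {E F : Ω → Prop} (h : ∀ ω, E ω ↔ F ω) : prob q E = prob q F :=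
  congrArg (prob q) (funext fun ω => propext (h ω))

theorem prob_mono {q : Ω → ℝ} (hq : ∀ ω, 0 ≤ q ω) {E F : Ω → Prop}
    (h : ∀ ω, 0 < q ω → E ω → F ω) : prob q E ≤ prob q F := by
  refine Finset.sum_le_sum fun ω _ => ?_
  rcases (hq ω).lt_or_eq with h0 | h0
  · by_cases hE : E ω
    · simp [hE, h ω h0 hE]
    · simp only [hE, if_false]; split_ifs <;> simp [hq ω]
  · simp [← h0]

theorem prob_or_le {q : Ω → ℝ} (hq : ∀ ω, 0 ≤ q ω) (E F : Ω → Prop) :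
    prob q (fun ω => E ω ∨ F ω) ≤ prob q E + prob q F := by
  unfold prob
  rw [← Finset.sum_add_distrib]
  refine Finset.sum_le_sum fun ω _ => ?_
  have := hq ω
  by_cases hE : E ω <;> by_cases hF : F ω <;> simp [hE, hF, this]

theorem prob_eq_sum_mul (q : Ω → ℝ) (E : Ω → Prop) [DecidablePred E] :
    prob q E = ∑ ω, q ω * if E ω then 1 else 0 :=
  Finset.sum_congr rfl fun ω _ => by by_cases h : E ω <;> simp [h]

theorem prob_add_prob_not (q : Ω → ℝ) (E : Ω → Prop) :
    prob q E + prob q (fun ω => ¬ E ω) = ∑ ω, q ω := by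
  unfold prob
  rw [← Finset.sum_add_distrib]
  exact Finset.sum_congr rfl fun ω _ => by by_cases h : E ω <;> simp [h]

theorem law_nonneg {q : Ω → ℝ} (hq : ∀ ω, 0 ≤ q ω) (X : Ω → A) (a : A) : 0 ≤ law q X a :=
  prob_nonneg hq _

theorem law_le_law {q : Ω → ℝ} (hq : ∀ ω, 0 ≤ q ω) {X : Ω → A} {Y : Ω → B} {a : A} {b : B}
    (h : ∀ ω, X ω = a → Y ω = b) : law q X a ≤ law q Y b :=
  prob_mono hq fun ω _ => h ω

theorem law_congr (q : Ω → ℝ) {X : Ω → A} {Y : Ω → B} {a : A} {b : B}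
    (h : ∀ ω, X ω = a ↔ Y ω = b) : law q X a = law q Y b :=
  prob_congr q h

theorem le_law {q : Ω → ℝ} (hq : ∀ ω, 0 ≤ q ω) (X : Ω → A) (ω : Ω) : q ω ≤ law q X (X ω) := by
  classical
  have := Finset.single_le_sum (f := fun ω' => if X ω' = X ω then q ω' else 0)
    (fun ω' _ => by by_cases h : X ω' = X ω <;> simp [h, hq ω']) (Finset.mem_univ ω)
  simpa [law] using this

theorem law_pos {q : Ω → ℝ} (hq : ∀ ω, 0 ≤ q ω) (X : Ω → A) {ω : Ω} (h : 0 < q ω) :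
    0 < law q X (X ω) :=
  h.trans_le (le_law hq X ω)

theorem sum_law_mul [Fintype A] (q : Ω → ℝ) (X : Ω → A) (f : A → ℝ) :
    ∑ a, law q X a * f a = ∑ ω, q ω * f (X ω) := by
  classical
  simp only [law, Finset.sum_mul, ite_mul, zero_mul]
  rw [Finset.sum_comm]
  exact Finset.sum_congr rfl fun ω _ => by simp

theorem sum_law [Fintype A] (q : Ω → ℝ) (X : Ω → A) : ∑ a, law q X a = ∑ ω, q ω := by
  simpa using sum_law_mul q X fun _ => 1

theorem prob_law [Fintype A] (q : Ω → ℝ) (X : Ω → A) (E : A → Prop) :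
    prob (law q X) E = prob q fun ω => E (X ω) := by
  classical
  rw [prob_eq_sum_mul, prob_eq_sum_mul, sum_law_mul]

theorem law_law [Fintype A] (q : Ω → ℝ) (X : Ω → A) (f : A → B) :
    law (law q X) f = law q fun ω => f (X ω) :=
  funext fun b => prob_law q X fun a => f a = b

theorem law_id (q : Ω → ℝ) : law q (fun ω => ω) = q := by
  classical
  funext ω
  simp [law]

theorem sum_law_pair_left [Fintype A] (q : Ω → ℝ) (X : Ω → A) (Y : Ω → B) (b : B) :
    ∑ a, law q (fun ω => (X ω, Y ω)) (a, b) = law q Y b := by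
  classical
  simp only [law, Prod.mk.injEq]
  rw [Finset.sum_comm]
  refine Finset.sum_congr rfl fun ω _ => ?_
  by_cases h : Y ω = b <;> simp [h]

theorem sum_law_pair_right [Fintype B] (q : Ω → ℝ) (X : Ω → A) (Y : Ω → B) (a : A) :
    ∑ b, law q (fun ω => (X ω, Y ω)) (a, b) = law q X a := by
  rw [← sum_law_pair_left q Y X a]
  exact Finset.sum_congr rfl fun b _ => law_congr q fun ω => by simp [and_comm]

open Classical in
theorem law_pair_comp [Fintype C] {D : Type*} (q : Ω → ℝ) (W : Ω → A) (Z : Ω → C) (f : C → D)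
    (a : A) (d : D) :
    law q (fun ω => (W ω, f (Z ω))) (a, d) =
      ∑ z, if f z = d then law q (fun ω => (W ω, Z ω)) (a, z) else 0 := by
  have h : ∀ z, (if f z = d then law q (fun ω => (W ω, Z ω)) (a, z) else 0) =
      ∑ ω, if Z ω = z then (if W ω = a ∧ f (Z ω) = d then q ω else 0) else 0 := by
    intro z
    by_cases h : f z = d
    · rw [if_pos h]
      refine Finset.sum_congr rfl fun ω _ => ?_
      by_cases h1 : Z ω = z
      · subst h1; simp [h]
      · simp [h1]
    · rw [if_neg h, Finset.sum_eq_zero]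
      intro ω _
      by_cases h1 : Z ω = z
      · subst h1; simp [h]
      · simp [h1]
  simp only [h]
  rw [Finset.sum_comm]
  exact Finset.sum_congr rfl fun ω _ => by simp

/-- Both sides of the Markov identity are linear in the laws that involve `Z`, so it can be summed
over a fibre of `f`. -/
theorem IsMarkovChain.comp_right [Fintype C] {D : Type*} {q : Ω → ℝ} {X : Ω → A} {Y : Ω → B}
    {Z : Ω → C} (h : IsMarkovChain q X Y Z) (f : C → D) :
    IsMarkovChain q X Y fun ω => f (Z ω) := by
  classical
  intro x y d
  have h1 : ∀ {E : Type _} (T : Ω → E) (e : E),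
      law q (fun ω => (X ω, Y ω, T ω)) (x, y, e) =
        law q (fun ω => ((X ω, Y ω), T ω)) ((x, y), e) :=
    fun T e => law_congr q fun ω => by simp [and_assoc]
  rw [h1, law_pair_comp, law_pair_comp q Y Z f, Finset.sum_mul, Finset.mul_sum]
  refine Finset.sum_congr rfl fun z _ => ?_
  split_ifs
  · rw [← h x y z, law_congr q (X := fun ω => (X ω, Y ω, Z ω)) (Y := fun ω => ((X ω, Y ω), Z ω))
      (b := ((x, y), z)) fun ω => by simp [and_assoc]]
  · simp

end Law

/-! ### Entropy -/

section Entropy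

variable {Ω A B C : Type*} [Fintype Ω]

/-- The entropy of `X` in bits, written as an expectation. -/
noncomputable def entropy (q : Ω → ℝ) (X : Ω → A) : ℝ :=
  -∑ ω, q ω * Real.logb 2 (law q X (X ω))

/-- The entropy of a random variable depends only on the partition it induces. -/
theorem entropy_congr (q : Ω → ℝ) {X : Ω → A} {Y : Ω → B}
    (h : ∀ ω ω', X ω = X ω' ↔ Y ω = Y ω') : entropy q X = entropy q Y := by
  unfold entropy
  congr 1
  exact Finset.sum_congr rfl fun ω _ => by rw [law_congr q fun ω' => h ω' ω]

theorem entropy_law [Fintype A] (q : Ω → ℝ) (X : Ω → A) (f : A → B) :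
    entropy (law q X) f = entropy q fun ω => f (X ω) := by
  unfold entropy
  rw [sum_law_mul q X fun a => Real.logb 2 (law (law q X) f (f a)), law_law]

/-- Logarithms of products and quotients are split only on the support of `q`, where all the laws
that occur are positive. -/
theorem sum_mul_eq_sum_mul_of_pos {q : Ω → ℝ} (hq : ∀ ω, 0 ≤ q ω) {f g : Ω → ℝ}
    (h : ∀ ω, 0 < q ω → f ω = g ω) : ∑ ω, q ω * f ω = ∑ ω, q ω * g ω := by
  refine Finset.sum_congr rfl fun ω _ => ?_
  rcases (hq ω).lt_or_eq with h0 | h0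
  · rw [h ω h0]
  · simp [← h0]

theorem sum_mul_le_sum_mul_of_pos {q : Ω → ℝ} (hq : ∀ ω, 0 ≤ q ω) {f g : Ω → ℝ}
    (h : ∀ ω, 0 < q ω → f ω ≤ g ω) : ∑ ω, q ω * f ω ≤ ∑ ω, q ω * g ω := by
  refine Finset.sum_le_sum fun ω _ => ?_
  rcases (hq ω).lt_or_eq with h0 | h0
  · exact mul_le_mul_of_nonneg_left (h ω h0) (hq ω)
  · simp [← h0]

/-! ### Information measures as expectations and as combinations of entropies -/

theorem condEntropy_eq_sum [Fintype A] [Fintype B] (q : Ω → ℝ) (X : Ω → A) (Y : Ω → B) :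
    condEntropy q X Y = ∑ ω, q ω *
      -Real.logb 2 (law q (fun ω => (X ω, Y ω)) (X ω, Y ω) / law q Y (Y ω)) := by
  simp only [condEntropy, mul_neg, Finset.sum_neg_distrib]
  rw [← Fintype.sum_prod_type' (f := fun x y => law q (fun ω => (X ω, Y ω)) (x, y) *
    Real.logb 2 (law q (fun ω => (X ω, Y ω)) (x, y) / law q Y y))]
  rw [← sum_law_mul q (fun ω => (X ω, Y ω)) fun a =>
    Real.logb 2 (law q (fun ω => (X ω, Y ω)) a / law q Y a.2)]

theorem mutualInfo_eq_sum [Fintype A] [Fintype B] (q : Ω → ℝ) (X : Ω → A) (Y : Ω → B) :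
    mutualInfo q X Y = ∑ ω, q ω * Real.logb 2 (law q (fun ω => (X ω, Y ω)) (X ω, Y ω) /
      (law q X (X ω) * law q Y (Y ω))) := by
  simp only [mutualInfo]
  rw [← Fintype.sum_prod_type' (f := fun x y => law q (fun ω => (X ω, Y ω)) (x, y) *
    Real.logb 2 (law q (fun ω => (X ω, Y ω)) (x, y) / (law q X x * law q Y y)))]
  rw [← sum_law_mul q (fun ω => (X ω, Y ω)) fun a =>
    Real.logb 2 (law q (fun ω => (X ω, Y ω)) a / (law q X a.1 * law q Y a.2))]

theorem condMutualInfo_eq_sum [Fintype A] [Fintype B] [Fintype C] (q : Ω → ℝ) (X : Ω → A)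
    (Y : Ω → B) (Z : Ω → C) :
    condMutualInfo q X Y Z = ∑ ω, q ω *
      Real.logb 2 ((law q (fun ω => (X ω, Y ω, Z ω)) (X ω, Y ω, Z ω) / law q Z (Z ω)) /
      ((law q (fun ω => (X ω, Z ω)) (X ω, Z ω) / law q Z (Z ω)) *
        (law q (fun ω => (Y ω, Z ω)) (Y ω, Z ω) / law q Z (Z ω)))) := by
  rw [← sum_law_mul q (fun ω => (X ω, Y ω, Z ω)) fun a =>
    Real.logb 2 ((law q (fun ω => (X ω, Y ω, Z ω)) a / law q Z a.2.2) /
      ((law q (fun ω => (X ω, Z ω)) (a.1, a.2.2) / law q Z a.2.2) *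
        (law q (fun ω => (Y ω, Z ω)) a.2 / law q Z a.2.2)))]
  simp only [condMutualInfo, Fintype.sum_prod_type]

theorem condEntropy_eq [Fintype A] [Fintype B] {q : Ω → ℝ} (hq : ∀ ω, 0 ≤ q ω) (X : Ω → A)
    (Y : Ω → B) :
    condEntropy q X Y = entropy q (fun ω => (X ω, Y ω)) - entropy q Y := by
  rw [condEntropy_eq_sum, sum_mul_eq_sum_mul_of_pos hq (g := fun ω =>
    -Real.logb 2 (law q (fun ω => (X ω, Y ω)) (X ω, Y ω)) + Real.logb 2 (law q Y (Y ω)))]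
  · simp only [entropy, mul_add, Finset.sum_add_distrib, mul_neg, Finset.sum_neg_distrib]
    ring
  · intro ω h
    rw [Real.logb_div (law_pos hq (fun ω => (X ω, Y ω)) h).ne' (law_pos hq Y h).ne']
    ring

theorem mutualInfo_eq [Fintype A] [Fintype B] {q : Ω → ℝ} (hq : ∀ ω, 0 ≤ q ω) (X : Ω → A)
    (Y : Ω → B) :
    mutualInfo q X Y = entropy q X + entropy q Y - entropy q (fun ω => (X ω, Y ω)) := by
  rw [mutualInfo_eq_sum, sum_mul_eq_sum_mul_of_pos hq (g := fun ω =>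
    Real.logb 2 (law q (fun ω => (X ω, Y ω)) (X ω, Y ω)) + -Real.logb 2 (law q X (X ω))
      + -Real.logb 2 (law q Y (Y ω)))]
  · simp only [entropy, mul_add, Finset.sum_add_distrib, mul_neg, Finset.sum_neg_distrib]
    ring
  · intro ω h
    have hX := (law_pos hq X h).ne'
    have hY := (law_pos hq Y h).ne'
    rw [Real.logb_div (law_pos hq (fun ω => (X ω, Y ω)) h).ne' (mul_ne_zero hX hY),
      Real.logb_mul hX hY]
    ring

theorem condMutualInfo_eq [Fintype A] [Fintype B] [Fintype C] {q : Ω → ℝ} (hq : ∀ ω, 0 ≤ q ω)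
    (X : Ω → A) (Y : Ω → B) (Z : Ω → C) :
    condMutualInfo q X Y Z = entropy q (fun ω => (X ω, Z ω)) + entropy q (fun ω => (Y ω, Z ω))
      - entropy q (fun ω => (X ω, Y ω, Z ω)) - entropy q Z := by
  rw [condMutualInfo_eq_sum, sum_mul_eq_sum_mul_of_pos hq (g := fun ω =>
    Real.logb 2 (law q (fun ω => (X ω, Y ω, Z ω)) (X ω, Y ω, Z ω))
      + -Real.logb 2 (law q (fun ω => (X ω, Z ω)) (X ω, Z ω))
      + -Real.logb 2 (law q (fun ω => (Y ω, Z ω)) (Y ω, Z ω)) + Real.logb 2 (law q Z (Z ω)))]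
  · simp only [entropy, mul_add, Finset.sum_add_distrib, mul_neg, Finset.sum_neg_distrib]
    ring
  · intro ω h
    have hZ := (law_pos hq Z h).ne'
    have hXZ := (law_pos hq (fun ω => (X ω, Z ω)) h).ne'
    have hYZ := (law_pos hq (fun ω => (Y ω, Z ω)) h).ne'
    have hXYZ := (law_pos hq (fun ω => (X ω, Y ω, Z ω)) h).ne'
    rw [Real.logb_div (div_ne_zero hXYZ hZ) (mul_ne_zero (div_ne_zero hXZ hZ)
      (div_ne_zero hYZ hZ)), Real.logb_mul (div_ne_zero hXZ hZ) (div_ne_zero hYZ hZ),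
      Real.logb_div hXYZ hZ, Real.logb_div hXZ hZ, Real.logb_div hYZ hZ]
    ring

/-- Gibbs' inequality in expectation form: if `E[F] ≤ 1` then `E[log₂ F] ≤ 0`. -/
theorem sum_mul_logb_nonpos {q : Ω → ℝ} (hq : q ∈ stdSimplex ℝ Ω) {F : Ω → ℝ}
    (hF : ∀ ω, 0 < q ω → 0 < F ω) (h : ∑ ω, q ω * F ω ≤ 1) :
    ∑ ω, q ω * Real.logb 2 (F ω) ≤ 0 := by
  have h2 : 0 < Real.log 2 := Real.log_pos one_lt_two
  calc ∑ ω, q ω * Real.logb 2 (F ω) ≤ ∑ ω, q ω * ((F ω - 1) / Real.log 2) := by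
        refine sum_mul_le_sum_mul_of_pos hq.1 fun ω hω => ?_
        exact div_le_div_of_nonneg_right (Real.log_le_sub_one_of_pos (hF ω hω)) h2.le
    _ = (∑ ω, q ω * F ω - ∑ ω, q ω) / Real.log 2 := by
        rw [← Finset.sum_sub_distrib, Finset.sum_div]
        exact Finset.sum_congr rfl fun ω _ => by ring
    _ ≤ 0 := by
        rw [hq.2]
        exact div_nonpos_of_nonpos_of_nonneg (by linarith) h2.le

theorem entropy_le_logb_card [Fintype A] {q : Ω → ℝ} (hq : q ∈ stdSimplex ℝ Ω) (X : Ω → A) :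
    entropy q X ≤ Real.logb 2 (Fintype.card A) := by
  classical
  obtain ⟨ω₀⟩ : Nonempty Ω := by
    by_contra hne
    rw [not_nonempty_iff] at hne
    simpa using hq.2
  have hc : (0 : ℝ) < Fintype.card A := by
    exact_mod_cast Fintype.card_pos_iff.mpr ⟨X ω₀⟩
  -- The likelihood ratio of the uniform law to the law of `X`; its mean is the fraction of values
  -- in the support, hence at most 1.
  have key := sum_mul_logb_nonpos hq (F := fun ω => (law q X (X ω))⁻¹ / Fintype.card A)
    (fun ω h => div_pos (inv_pos.mpr (law_pos hq.1 X h)) hc) (by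
      rw [← sum_law_mul q X fun a => (law q X a)⁻¹ / Fintype.card A]
      calc ∑ a, law q X a * ((law q X a)⁻¹ / Fintype.card A)
          ≤ ∑ _a : A, 1 / (Fintype.card A : ℝ) := by
            refine Finset.sum_le_sum fun a _ => ?_
            rw [← mul_div_assoc]
            exact div_le_div_of_nonneg_right mul_inv_le_one hc.le
        _ = 1 := by simp [hc.ne'])
  rw [sum_mul_eq_sum_mul_of_pos hq.1 (g := fun ω => -Real.logb 2 (law q X (X ω)) -
    Real.logb 2 (Fintype.card A))] at key
  · simp only [mul_sub, mul_neg, Finset.sum_sub_distrib, ← Finset.sum_mul, hq.2,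
      Finset.sum_neg_distrib] at key
    unfold entropy
    linarith
  · intro ω h
    rw [Real.logb_div (inv_pos.mpr (law_pos hq.1 X h)).ne' hc.ne', Real.logb_inv]

theorem entropy_mono {q : Ω → ℝ} (hq : ∀ ω, 0 ≤ q ω) {X : Ω → A} {Y : Ω → B}
    (h : ∀ ω ω', Y ω = Y ω' → X ω = X ω') : entropy q X ≤ entropy q Y := by
  unfold entropy
  rw [neg_le_neg_iff]
  refine sum_mul_le_sum_mul_of_pos hq fun ω hω => ?_
  exact Real.logb_le_logb_of_le one_lt_two (law_pos hq Y hω) (law_le_law hq fun ω' => h ω' ω)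

/-- Strong subadditivity of entropy. -/
theorem entropy_submodular [Fintype A] [Fintype B] [Fintype C] {q : Ω → ℝ}
    (hq : q ∈ stdSimplex ℝ Ω) (X : Ω → A) (Y : Ω → B) (Z : Ω → C) :
    entropy q (fun ω => (X ω, Y ω, Z ω)) + entropy q Z ≤
      entropy q (fun ω => (X ω, Z ω)) + entropy q (fun ω => (Y ω, Z ω)) := by
  -- `F = p(x,z) p(y,z) / (p(x,y,z) p(z))`, the ratio of the law that makes `X` and `Y`
  -- conditionally independent given `Z` to the true one. Its mean is at most 1 and its mean
  -- logarithm is `-I(X; Y | Z)`.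
  set F : A × B × C → ℝ := fun a => law q (fun ω => (X ω, Z ω)) (a.1, a.2.2) *
    law q (fun ω => (Y ω, Z ω)) a.2 / (law q (fun ω => (X ω, Y ω, Z ω)) a * law q Z a.2.2)
  have key := sum_mul_logb_nonpos hq (F := fun ω => F (X ω, Y ω, Z ω))
    (fun ω h => div_pos
      (mul_pos (law_pos hq.1 (fun ω => (X ω, Z ω)) h) (law_pos hq.1 (fun ω => (Y ω, Z ω)) h))
      (mul_pos (law_pos hq.1 (fun ω => (X ω, Y ω, Z ω)) h) (law_pos hq.1 Z h))) (by
      rw [← sum_law_mul q (fun ω => (X ω, Y ω, Z ω)) F]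
      calc ∑ a, law q (fun ω => (X ω, Y ω, Z ω)) a * F a
          ≤ ∑ a : A × B × C, law q (fun ω => (X ω, Z ω)) (a.1, a.2.2) *
              (law q (fun ω => (Y ω, Z ω)) a.2 / law q Z a.2.2) := by
            refine Finset.sum_le_sum fun a _ => ?_
            have h1 := law_nonneg hq.1 (fun ω => (X ω, Z ω)) (a.1, a.2.2)
            have h2 := law_nonneg hq.1 (fun ω => (Y ω, Z ω)) a.2
            have h3 := law_nonneg hq.1 Z a.2.2
            have h4 := law_nonneg hq.1 (fun ω => (X ω, Y ω, Z ω)) a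
            rcases h4.eq_or_lt with h | h
            · rw [← h]; simp only [zero_mul]; positivity
            · exact le_of_eq (by simp only [F]; field_simp)
        _ = ∑ b : B × C, law q Z b.2 * (law q (fun ω => (Y ω, Z ω)) b / law q Z b.2) := by
            rw [Fintype.sum_prod_type_right]
            refine Finset.sum_congr rfl fun b _ => ?_
            simp only [← Finset.sum_mul, sum_law_pair_left]
        _ ≤ ∑ b : B × C, law q (fun ω => (Y ω, Z ω)) b := by
            refine Finset.sum_le_sum fun b _ => ?_
            rcases (law_nonneg hq.1 Z b.2).eq_or_lt with h | h
            · rw [← h, zero_mul]; exact law_nonneg hq.1 _ _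
            · exact le_of_eq (by field_simp)
        _ = 1 := by rw [sum_law, hq.2])
  rw [sum_mul_eq_sum_mul_of_pos hq.1 (g := fun ω =>
    Real.logb 2 (law q (fun ω => (X ω, Z ω)) (X ω, Z ω))
      + Real.logb 2 (law q (fun ω => (Y ω, Z ω)) (Y ω, Z ω))
      - Real.logb 2 (law q (fun ω => (X ω, Y ω, Z ω)) (X ω, Y ω, Z ω))
      - Real.logb 2 (law q Z (Z ω)))] at key
  · simp only [mul_sub, mul_add, Finset.sum_sub_distrib, Finset.sum_add_distrib] at key
    unfold entropy
    linarith
  · intro ω h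
    have hZ := (law_pos hq.1 Z h).ne'
    have hXZ := (law_pos hq.1 (fun ω => (X ω, Z ω)) h).ne'
    have hYZ := (law_pos hq.1 (fun ω => (Y ω, Z ω)) h).ne'
    have hXYZ := (law_pos hq.1 (fun ω => (X ω, Y ω, Z ω)) h).ne'
    simp only [F]
    rw [Real.logb_div (mul_ne_zero hXZ hYZ) (mul_ne_zero hXYZ hZ), Real.logb_mul hXZ hYZ,
      Real.logb_mul hXYZ hZ]
    ring

theorem entropy_const [Fintype A] {q : Ω → ℝ} (hq : q ∈ stdSimplex ℝ Ω) (a : A) :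
    entropy q (fun _ => a) = 0 := by
  have : law q (fun _ : Ω => a) a = 1 := by simp [law, hq.2]
  simp [entropy, this]

theorem entropy_pair_le [Fintype A] [Fintype B] {q : Ω → ℝ} (hq : q ∈ stdSimplex ℝ Ω)
    (X : Ω → A) (Y : Ω → B) :
    entropy q (fun ω => (X ω, Y ω)) ≤ entropy q X + entropy q Y := by
  have h := entropy_submodular hq X Y fun _ => ()
  rw [entropy_const hq, add_zero] at h
  rwa [entropy_congr q (X := fun ω => (X ω, Y ω, ())) (Y := fun ω => (X ω, Y ω)) (by simp),
    entropy_congr q (X := fun ω => (X ω, ())) (Y := X) (by simp),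
    entropy_congr q (X := fun ω => (Y ω, ())) (Y := Y) (by simp)] at h

theorem condEntropy_nonneg [Fintype A] [Fintype B] {q : Ω → ℝ} (hq : ∀ ω, 0 ≤ q ω)
    (X : Ω → A) (Y : Ω → B) : 0 ≤ condEntropy q X Y := by
  rw [condEntropy_eq hq, sub_nonneg]
  exact entropy_mono hq fun ω ω' h => (Prod.mk.inj h).2

theorem mutualInfo_nonneg [Fintype A] [Fintype B] {q : Ω → ℝ} (hq : q ∈ stdSimplex ℝ Ω)
    (X : Ω → A) (Y : Ω → B) : 0 ≤ mutualInfo q X Y := by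
  rw [mutualInfo_eq hq.1, sub_nonneg]
  exact entropy_pair_le hq X Y

theorem condMutualInfo_nonneg [Fintype A] [Fintype B] [Fintype C] {q : Ω → ℝ}
    (hq : q ∈ stdSimplex ℝ Ω) (X : Ω → A) (Y : Ω → B) (Z : Ω → C) :
    0 ≤ condMutualInfo q X Y Z := by
  rw [condMutualInfo_eq hq.1]
  linarith [entropy_submodular hq X Y Z]

/-- Fano's inequality. -/
theorem entropy_pair_sub_le_fano [Fintype A] {q : Ω → ℝ} (hq : q ∈ stdSimplex ℝ Ω)
    (X Y : Ω → A) :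
    entropy q (fun ω => (X ω, Y ω)) - entropy q Y ≤
      1 + prob q (fun ω => X ω ≠ Y ω) * Real.logb 2 (Fintype.card A) := by
  classical
  obtain ⟨ω₀⟩ : Nonempty Ω := by
    by_contra hne
    rw [not_nonempty_iff] at hne
    simpa using hq.2
  have hc : (1 : ℝ) ≤ Fintype.card A := by
    exact_mod_cast Fintype.card_pos_iff.mpr ⟨X ω₀⟩
  have hc0 : (0 : ℝ) < Fintype.card A := by linarith
  -- A test conditional law: half the mass guesses `X = Y`, half is uniform. Its log-loss is at most
  -- 1 when the guess is right and `1 + log₂ |A|` otherwise, so no binary entropy appears.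
  set r : A → A → ℝ := fun a b => (if a = b then 1 / 2 else 0) + 1 / (2 * Fintype.card A)
  have hr : ∀ a b, 0 < r a b := fun a b => by
    simp only [r]; split_ifs <;> positivity
  have hrsum : ∀ b, ∑ a, r a b = 1 := fun b => by
    simp only [r, Finset.sum_add_distrib, Finset.sum_ite_eq', Finset.mem_univ, if_true,
      Finset.sum_const, Finset.card_univ, nsmul_eq_mul]
    field_simp
    norm_num
  set F : A × A → ℝ := fun a => law q Y a.2 * r a.1 a.2 / law q (fun ω => (X ω, Y ω)) a
  have key := sum_mul_logb_nonpos hq (F := fun ω => F (X ω, Y ω))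
    (fun ω h => div_pos (mul_pos (law_pos hq.1 Y h) (hr _ _))
      (law_pos hq.1 (fun ω => (X ω, Y ω)) h)) (by
      rw [← sum_law_mul q (fun ω => (X ω, Y ω)) F]
      calc ∑ a, law q (fun ω => (X ω, Y ω)) a * F a
          ≤ ∑ a : A × A, law q Y a.2 * r a.1 a.2 := by
            refine Finset.sum_le_sum fun a _ => ?_
            rcases (law_nonneg hq.1 (fun ω => (X ω, Y ω)) a).eq_or_lt with h | h
            · rw [← h, zero_mul]
              exact mul_nonneg (law_nonneg hq.1 _ _) (hr _ _).le
            · exact le_of_eq (by simp only [F]; field_simp)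
        _ = ∑ b, law q Y b := by
            rw [Fintype.sum_prod_type_right]
            exact Finset.sum_congr rfl fun b _ => by simp only [← Finset.mul_sum, hrsum, mul_one]
        _ ≤ 1 := by rw [sum_law, hq.2])
  rw [sum_mul_eq_sum_mul_of_pos hq.1 (g := fun ω =>
    Real.logb 2 (law q Y (Y ω)) + Real.logb 2 (r (X ω) (Y ω))
      - Real.logb 2 (law q (fun ω => (X ω, Y ω)) (X ω, Y ω)))] at key
  · have hr2 : ∑ ω, q ω * (-1 - (if X ω ≠ Y ω then 1 else 0) * Real.logb 2 (Fintype.card A)) ≤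
        ∑ ω, q ω * Real.logb 2 (r (X ω) (Y ω)) := by
      refine sum_mul_le_sum_mul_of_pos hq.1 fun ω _ => ?_
      have hhalf : Real.logb 2 (1 / 2) = -1 := by
        rw [one_div, Real.logb_inv, Real.logb_self_eq_one one_lt_two]
      by_cases h : X ω = Y ω
      · simp only [h, ne_eq, not_true_eq_false, if_false, zero_mul, sub_zero]
        rw [← hhalf]
        refine Real.logb_le_logb_of_le one_lt_two (by norm_num) ?_
        simp only [r, if_true]
        have : 0 < 1 / (2 * (Fintype.card A : ℝ)) := by positivity
        linarith
      · simp only [ne_eq, h, not_false_eq_true, if_true, one_mul, r, if_false, zero_add]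
        rw [one_div, Real.logb_inv, Real.logb_mul two_ne_zero hc0.ne',
          Real.logb_self_eq_one one_lt_two]
        linarith
    simp only [mul_sub, mul_add, Finset.sum_sub_distrib, Finset.sum_add_distrib, ← mul_assoc,
      ← Finset.sum_mul, hq.2, mul_neg, mul_one, Finset.sum_neg_distrib] at key hr2
    rw [← prob_eq_sum_mul] at hr2
    unfold entropy
    linarith
  · intro ω h
    simp only [F]
    rw [Real.logb_div (mul_ne_zero (law_pos hq.1 Y h).ne' (hr _ _).ne')
      (law_pos hq.1 (fun ω => (X ω, Y ω)) h).ne', Real.logb_mul (law_pos hq.1 Y h).ne'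
      (hr _ _).ne']

end Entropy

/-! ### Product mass functions -/

section Product

variable {Ω A : Type*}

/-- The mass function of `n` i.i.d. copies. -/
def iidMass (n : ℕ) (q : Ω → ℝ) (x : Fin n → Ω) : ℝ := ∏ i, q (x i)

theorem pos_of_iidMass_pos {n : ℕ} {q : Ω → ℝ} (hq : ∀ ω, 0 ≤ q ω) {x : Fin n → Ω}
    (h : 0 < iidMass n q x) (i : Fin n) : 0 < q (x i) :=
  (hq _).lt_of_ne' fun h0 => h.ne' (Finset.prod_eq_zero (Finset.mem_univ i) h0)

variable [Fintype Ω]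

theorem sum_iidMass_mul_prod (n : ℕ) (q : Ω → ℝ) (f : Fin n → Ω → ℝ) :
    ∑ x, iidMass n q x * ∏ i, f i (x i) = ∏ i, ∑ ω, q ω * f i ω := by
  classical
  simp only [iidMass, ← Finset.prod_mul_distrib]
  rw [Finset.prod_univ_sum, Fintype.piFinset_univ]

theorem iidMass_mem_stdSimplex (n : ℕ) {q : Ω → ℝ} (hq : q ∈ stdSimplex ℝ Ω) :
    iidMass n q ∈ stdSimplex ℝ (Fin n → Ω) := by
  refine ⟨fun x => Finset.prod_nonneg fun i _ => hq.1 _, ?_⟩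
  simpa [hq.2] using sum_iidMass_mul_prod n q fun _ _ => 1

/-- The law of a family of functions of the separate coordinates is a product. -/
theorem law_iidMass (n : ℕ) (q : Ω → ℝ) (W : Fin n → Ω → A) (c : Fin n → A) :
    law (iidMass n q) (fun x j => W j (x j)) c = ∏ j, law q (W j) (c j) := by
  classical
  have h := sum_iidMass_mul_prod n q fun j ω => if W j ω = c j then 1 else 0
  simp only [mul_ite, mul_one, mul_zero] at h
  simp only [law]
  convert h using 2 with x
  rw [Finset.prod_ite_zero]
  by_cases hx : (fun j => W j (x j)) = c
  · simp [← hx]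
  · rw [if_neg hx, if_neg, mul_zero]
    exact fun h' => hx (funext fun j => h' j (Finset.mem_univ j))

theorem sum_iidMass_mul_coord (n : ℕ) {q : Ω → ℝ} (hq : q ∈ stdSimplex ℝ Ω) (j : Fin n)
    (f : Ω → ℝ) : ∑ x, iidMass n q x * f (x j) = ∑ ω, q ω * f ω := by
  classical
  have h := sum_iidMass_mul_prod n q fun i ω => if i = j then f ω else 1
  simp only [Finset.prod_ite_eq', Finset.mem_univ, if_true] at h
  rw [h, Finset.prod_eq_single j]
  · simp
  · intro i _ hi
    simp [hi, hq.2]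
  · simp

/-- The functions may vary with the coordinate, which later allows blocks in which some letters are
erased. -/
theorem entropy_iidMass (n : ℕ) {q : Ω → ℝ} (hq : q ∈ stdSimplex ℝ Ω) (W : Fin n → Ω → A) :
    entropy (iidMass n q) (fun x j => W j (x j)) = ∑ j, entropy q (W j) := by
  have hQ := iidMass_mem_stdSimplex n hq
  unfold entropy
  rw [sum_mul_eq_sum_mul_of_pos hQ.1 (g := fun x =>
    ∑ j, Real.logb 2 (law q (W j) (W j (x j))))]
  · simp only [Finset.mul_sum]
    rw [Finset.sum_comm, Finset.sum_neg_distrib]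
    congr 1
    exact Finset.sum_congr rfl fun j _ =>
      sum_iidMass_mul_coord n hq j fun ω => Real.logb 2 (law q (W j) (W j ω))
  · intro x hx
    rw [law_iidMass, Real.logb_prod]
    exact fun j _ => (law_pos hq.1 (W j) (pos_of_iidMass_pos hq.1 hx j)).ne'

end Product

/-! ### Random coding lemmas -/

section RandomCoding

/-- The step from random coding to a deterministic code: some outcome does no worse than the
average. -/
theorem exists_le_of_weighted_sum_le {ι : Type*} [Fintype ι] {w f : ι → ℝ} {b : ℝ}
    (hw : w ∈ stdSimplex ℝ ι) (h : ∑ i, w i * f i ≤ b) : ∃ i, f i ≤ b := by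
  by_contra! hlt
  obtain ⟨i, hi⟩ : ∃ i, 0 < w i := by
    by_contra! hle
    have := Finset.sum_nonpos fun i (_ : i ∈ Finset.univ) => hle i
    rw [hw.2] at this
    linarith
  have : ∑ i, w i * b < ∑ i, w i * f i :=
    Finset.sum_lt_sum (fun j _ => mul_le_mul_of_nonneg_left (hlt j).le (hw.1 j))
      ⟨i, Finset.mem_univ i, mul_lt_mul_of_pos_left (hlt i) hi⟩
  rw [← Finset.sum_mul, hw.2, one_mul] at this
  linarith

/-- Here `g` is the chance that a random codeword is good and `a` the chance under the true
conditional law. Since `1 - g ≤ exp (-a / Γ)`, convexity of `exp` between `0` and `-M / Γ` with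
weight `a` gives the bound. -/
theorem one_sub_pow_le {g a Γ : ℝ} (M : ℕ) (hΓ : 0 < Γ) (ha : 0 ≤ a) (ha1 : a ≤ 1)
    (hag : a ≤ Γ * g) (hg : g ≤ 1) : (1 - g) ^ M ≤ 1 - a + Real.exp (-(M / Γ)) := by
  have h1 : a / Γ ≤ g := by rwa [div_le_iff₀ hΓ, mul_comm]
  have h2 : 1 - g ≤ Real.exp (-(a / Γ)) := by
    linarith [Real.add_one_le_exp (-(a / Γ))]
  calc (1 - g) ^ M ≤ Real.exp (-(a / Γ)) ^ M := pow_le_pow_left₀ (by linarith) h2 M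
    _ = Real.exp ((1 - a) * 0 + a * (-(M / Γ))) := by
        rw [← Real.exp_nat_mul]; congr 1; ring
    _ ≤ (1 - a) * Real.exp 0 + a * Real.exp (-(M / Γ)) := by
        simpa using convexOn_exp.2 (Set.mem_univ 0) (Set.mem_univ (-(M / Γ)))
          (by linarith : 0 ≤ 1 - a) ha (by ring)
    _ ≤ 1 - a + Real.exp (-(M / Γ)) := by
        rw [Real.exp_zero, mul_one]
        have := Real.exp_pos (-(M / Γ))
        nlinarith

/-- One-shot covering: some codebook of size `M` covers all `x` through the relation `G`, up to
the stated weight. -/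
theorem exists_covering_codebook {X U : Type*} [Fintype X] [Fintype U] [Nonempty U] {w : X → ℝ}
    (hw : ∀ x, 0 ≤ w x) {r : U → ℝ} (hr0 : ∀ u, 0 ≤ r u) (W : X → U → ℝ)
    (hW : ∀ x u, 0 ≤ W x u) (G : X → U → Prop) {Γ : ℝ} (hΓ : 0 < Γ)
    (hr : ∀ x, w x ≠ 0 → ∑ u, r u = 1)
    (hW1 : ∀ x, w x ≠ 0 → ∑ u, W x u = 1)
    (hG : ∀ x u, w x ≠ 0 → G x u → W x u ≤ Γ * r u) (M : ℕ) :
    ∃ c : Fin M → U, prob w (fun x => ∀ m, ¬ G x (c m)) ≤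
      ∑ x, w x * (prob (W x) (fun u => ¬ G x u) + Real.exp (-(M / Γ))) := by
  classical
  -- Normalisation of `r` is assumed only if some weight is nonzero, because in the use below `r` is
  -- a conditional law given a codeword that may have probability zero.
  by_cases hw0 : ∀ x, w x = 0
  · obtain ⟨u⟩ := ‹Nonempty U›
    exact ⟨fun _ => u, by simp [prob, hw0]⟩
  obtain ⟨x₀, hx₀⟩ := not_forall.mp hw0
  have hr' : r ∈ stdSimplex ℝ U := ⟨hr0, hr x₀ hx₀⟩
  refine exists_le_of_weighted_sum_le (iidMass_mem_stdSimplex M hr') ?_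
  -- With codewords drawn independently from `r`, all of them miss `x` with probability `(1 - r(G
  -- x)) ^ M`.
  have hswap : ∑ c, iidMass M r c * prob w (fun x => ∀ m, ¬ G x (c m)) =
      ∑ x, w x * (1 - prob r (G x)) ^ M := by
    simp only [prob_eq_sum_mul w, Finset.mul_sum]
    rw [Finset.sum_comm]
    refine Finset.sum_congr rfl fun x _ => ?_
    have h := sum_iidMass_mul_prod M r fun _ u => if ¬ G x u then 1 else 0
    have h1 : (1 : ℝ) - prob r (G x) = prob r fun u => ¬ G x u := by
      rw [← hr'.2, ← prob_add_prob_not r (G x)]; ring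
    rw [Finset.prod_const, Finset.card_univ, Fintype.card_fin, ← prob_eq_sum_mul, ← h1] at h
    rw [← h, Finset.mul_sum]
    refine Finset.sum_congr rfl fun c _ => ?_
    rw [Finset.prod_ite_zero]
    simp only [Finset.mem_univ, true_imp_iff, Finset.prod_const_one]
    ring
  rw [hswap]
  refine Finset.sum_le_sum fun x _ => ?_
  by_cases hx : w x = 0
  · simp [hx]
  refine mul_le_mul_of_nonneg_left ?_ (hw x)
  have h2 := prob_add_prob_not (W x) (G x)
  rw [hW1 x hx] at h2
  have h3 := prob_nonneg (hW x) fun u => ¬ G x u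
  have h4 := prob_nonneg (hW x) (G x)
  have h5 : prob (W x) (G x) ≤ Γ * prob r (G x) := by
    unfold prob
    rw [Finset.mul_sum]
    refine Finset.sum_le_sum fun u _ => ?_
    by_cases h : G x u
    · simpa [h] using hG x u hx h
    · simp [h]
  have h6 := prob_add_prob_not r (G x)
  rw [hr'.2] at h6
  have h7 := prob_nonneg hr0 fun u => ¬ G x u
  have := one_sub_pow_le M hΓ h4 (by linarith) h5 (by linarith)
  linarith

/-- Shifting `b x'` cyclically by `t` permutes the binnings, so the events `b x' + t = b x` are
equally frequent. Exactly one `t` occurs for each `b`; two distinct points therefore collide with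
probability `1 / L`. -/
theorem card_mul_sum_collision {X : Type*} [Fintype X] {L : ℕ} [NeZero L] {x x' : X}
    (h : x' ≠ x) [DecidableEq X] [DecidableEq (Fin L)] :
    (L : ℝ) * ∑ b : X → Fin L, (if b x' = b x then 1 else 0 : ℝ) =
      Fintype.card (X → Fin L) := by
  have hshift : ∀ t : Fin L, ∑ b : X → Fin L, (if b x' = b x then 1 else 0 : ℝ) =
      ∑ b : X → Fin L, if b x' + t = b x then 1 else 0 := by
    intro t
    let e : (X → Fin L) ≃ (X → Fin L) :=
      { toFun := fun b => Function.update b x' (b x' + t)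
        invFun := fun b => Function.update b x' (b x' - t)
        left_inv := fun b => by simp
        right_inv := fun b => by simp }
    refine (Equiv.sum_comp e fun b => if b x' = b x then (1 : ℝ) else 0).symm.trans ?_
    refine Finset.sum_congr rfl fun b _ => ?_
    simp [e, h.symm]
  calc (L : ℝ) * ∑ b : X → Fin L, (if b x' = b x then 1 else 0 : ℝ)
      = ∑ t : Fin L, ∑ b : X → Fin L, if b x' + t = b x then 1 else 0 := by
        rw [← Finset.sum_congr rfl fun t _ => hshift t]
        simp
    _ = ∑ b : X → Fin L, 1 := by
        rw [Finset.sum_comm]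
        refine Finset.sum_congr rfl fun b _ => ?_
        simp [← eq_sub_iff_add_eq']
    _ = Fintype.card (X → Fin L) := by simp

/-- Random binning: some assignment of bins separates `X` from all other elements of the list
`T S`, up to probability `N / L`. -/
theorem exists_binning {Ω X S : Type*} [Fintype Ω] [Fintype X] {q : Ω → ℝ}
    (hq : q ∈ stdSimplex ℝ Ω) (ξ : Ω → X) (σ : Ω → S) (T : S → X → Prop) {N : ℝ}
    (hT : ∀ s, prob (fun _ => 1) (T s) ≤ N) {L : ℕ} (hL : 0 < L) :
    ∃ b : X → Fin L,
      prob q (fun ω => ∃ x, x ≠ ξ ω ∧ b x = b (ξ ω) ∧ T (σ ω) x) ≤ N / L := by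
  classical
  have : NeZero L := ⟨hL.ne'⟩
  have hLr : (0 : ℝ) < L := by exact_mod_cast hL
  have hcard : (0 : ℝ) < Fintype.card (X → Fin L) := by exact_mod_cast Fintype.card_pos
  have hu : (fun _ => 1 / (Fintype.card (X → Fin L) : ℝ)) ∈ stdSimplex ℝ (X → Fin L) :=
    ⟨fun _ => by positivity, by
      rw [Finset.sum_const, Finset.card_univ, nsmul_eq_mul, mul_one_div, div_self hcard.ne']⟩
  refine exists_le_of_weighted_sum_le hu ?_
  -- Union bound over the wrong list elements; the list does not depend on `b`, so averaging over
  -- `b` acts on the collision indicator alone.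
  have hb : ∀ b : X → Fin L, prob q (fun ω => ∃ x, x ≠ ξ ω ∧ b x = b (ξ ω) ∧ T (σ ω) x) ≤
      ∑ ω, q ω * ∑ x, (if x ≠ ξ ω ∧ T (σ ω) x then 1 else 0) *
        (if b x = b (ξ ω) then 1 else 0) := by
    intro b
    rw [prob_eq_sum_mul]
    refine Finset.sum_le_sum fun ω _ => mul_le_mul_of_nonneg_left ?_ (hq.1 ω)
    have hnn : ∀ x ∈ Finset.univ, (0 : ℝ) ≤ (if x ≠ ξ ω ∧ T (σ ω) x then 1 else 0) *
        (if b x = b (ξ ω) then 1 else 0) := fun x _ => by split_ifs <;> simp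
    split_ifs with hex
    · obtain ⟨x, h1, h2, h3⟩ := hex
      refine le_trans ?_ (Finset.single_le_sum hnn (Finset.mem_univ x))
      simp [h1, h2, h3]
    · exact Finset.sum_nonneg hnn
  calc ∑ b : X → Fin L, 1 / (Fintype.card (X → Fin L) : ℝ) *
        prob q (fun ω => ∃ x, x ≠ ξ ω ∧ b x = b (ξ ω) ∧ T (σ ω) x)
      ≤ ∑ b : X → Fin L, 1 / (Fintype.card (X → Fin L) : ℝ) *
        ∑ ω, q ω * ∑ x, (if x ≠ ξ ω ∧ T (σ ω) x then 1 else 0) *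
          (if b x = b (ξ ω) then 1 else 0) :=
        Finset.sum_le_sum fun b _ => mul_le_mul_of_nonneg_left (hb b) (by positivity)
    _ = ∑ ω, q ω * ∑ x, (if x ≠ ξ ω ∧ T (σ ω) x then 1 else 0) *
          (1 / (Fintype.card (X → Fin L) : ℝ) *
            ∑ b : X → Fin L, (if b x = b (ξ ω) then 1 else 0)) := by
        simp only [Finset.mul_sum]
        rw [Finset.sum_comm]
        refine Finset.sum_congr rfl fun ω _ => ?_
        rw [Finset.sum_comm]
        exact Finset.sum_congr rfl fun x _ => Finset.sum_congr rfl fun b _ => by ring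
    _ ≤ ∑ ω, q ω * (N / L) := by
        refine Finset.sum_le_sum fun ω _ => mul_le_mul_of_nonneg_left ?_ (hq.1 ω)
        calc _ ≤ ∑ x, (if T (σ ω) x then 1 else 0) * (1 / (L : ℝ)) := by
              refine Finset.sum_le_sum fun x _ => ?_
              by_cases hx : x ≠ ξ ω ∧ T (σ ω) x
              · have := card_mul_sum_collision (L := L) hx.1
                rw [if_pos hx, if_pos hx.2, one_mul, one_mul, ← this]
                refine le_of_eq ?_
                have h0 : (∑ b : X → Fin L, (if b x = b (ξ ω) then 1 else 0 : ℝ)) ≠ 0 := by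
                  intro h0
                  rw [h0, mul_zero] at this
                  exact hcard.ne this
                field_simp
              · rw [if_neg hx, zero_mul]
                split_ifs <;> simp
          _ = prob (fun _ => 1) (T (σ ω)) / L := by
              rw [← Finset.sum_mul, mul_one_div]; rfl
          _ ≤ N / L := div_le_div_of_nonneg_right (hT _) hLr.le
    _ = N / L := by rw [← Finset.sum_mul, hq.2, one_mul]

/-- Markov's inequality for the conditional probability of `D Y Z` given `Y`. -/
theorem prob_condProb_gt_le {Ω B C : Type*} [Fintype Ω] [Fintype B] [Fintype C] {q : Ω → ℝ}
    (hq : ∀ ω, 0 ≤ q ω) (Y : Ω → B) (Z : Ω → C) (D : B → C → Prop) (δ : ℝ) :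
    δ * prob q (fun ω => δ * law q Y (Y ω) <
        prob (fun z => law q (fun ω => (Y ω, Z ω)) (Y ω, z)) (D (Y ω))) ≤
      prob q fun ω => D (Y ω) (Z ω) := by
  classical
  set h : B → ℝ := fun b => prob (fun z => law q (fun ω => (Y ω, Z ω)) (b, z)) (D b)
  have h0 : ∀ b, 0 ≤ h b := fun b => prob_nonneg (fun z => law_nonneg hq _ _) _
  have h1 : prob q (fun ω => D (Y ω) (Z ω)) = ∑ b, h b := by
    rw [← prob_law q (fun ω => (Y ω, Z ω)) fun a => D a.1 a.2]
    simp only [prob, Fintype.sum_prod_type, h]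
  rw [h1, ← prob_law q Y fun b => δ * law q Y b < h b]
  unfold prob
  rw [Finset.mul_sum]
  refine Finset.sum_le_sum fun b _ => ?_
  split_ifs with hlt
  · exact hlt.le
  · simpa using h0 b

end RandomCoding

/-! ### One-shot coding for the helper network -/

section OneShot

variable {Ω A B C D : Type*} [Fintype Ω]

theorem prob_mul_const (q : Ω → ℝ) (E : Ω → Prop) (c : ℝ) :
    prob (fun ω => q ω * c) E = prob q E * c := by
  unfold prob
  rw [Finset.sum_mul]
  exact Finset.sum_congr rfl fun ω _ => by split_ifs <;> simp

theorem prob_eq_prob_mass {q r : Ω → ℝ} (E : Ω → Prop) (h : ∀ ω, q ω = r ω) :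
    prob q E = prob r E := by
  rw [funext h]

theorem prob_prod [Fintype A] [Fintype B] (q : A × B → ℝ) (E : A → B → Prop) :
    prob q (fun a => E a.1 a.2) = ∑ a, prob (fun b => q (a, b)) (E a) := by
  simp only [prob, Fintype.sum_prod_type]

/-- The outcome `y` of `Y` belongs to the decoding list of `(u, v)`: its conditional probability
given `(U, V) = (u, v)` is at least `1 / N`. -/
def InList (q : Ω → ℝ) (Y : Ω → B) (U : Ω → C) (V : Ω → D) (N : ℝ) (u : C) (v : D) (y : B) :
    Prop :=
  0 < law q (fun ω => (U ω, V ω)) (u, v) ∧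
    law q (fun ω => (U ω, V ω)) (u, v) ≤ N * law q (fun ω => (Y ω, U ω, V ω)) (y, u, v)

/-- The refinement `v` suits `(x, u)`: the conditional information density of `x` and `v` given `u`
is at most `log Γ`, and given `X = x` the list of `(u, v)` rarely misses `Y`. -/
def RefinementSuits (q : Ω → ℝ) (X : Ω → A) (Y : Ω → B) (U : Ω → C) (V : Ω → D) [Fintype B]
    (Γ N δ : ℝ) (x : A) (u : C) (v : D) : Prop :=
  law q (fun ω => ((X ω, U ω), V ω)) ((x, u), v) * law q U u ≤
      Γ * (law q (fun ω => (X ω, U ω)) (x, u) * law q (fun ω => (V ω, U ω)) (v, u)) ∧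
    prob (fun y => law q (fun ω => (Y ω, X ω)) (y, x)) (fun y => ¬ InList q Y U V N u v y) ≤
      δ * law q X x

/-- Given `(X, U) = (x, u)`, the refinement `V` suits with probability at least `1 - δ`. -/
def Refinable (q : Ω → ℝ) (X : Ω → A) (Y : Ω → B) (U : Ω → C) (V : Ω → D) [Fintype B] [Fintype D]
    (Γ N δ : ℝ) (x : A) (u : C) : Prop :=
  prob (fun v => law q (fun ω => ((X ω, U ω), V ω)) ((x, u), v))
    (fun v => ¬ RefinementSuits q X Y U V Γ N δ x u v) ≤ δ * law q (fun ω => (X ω, U ω)) (x, u)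

/-- The mass `1` counts elements: those of conditional probability at least `1 / N` number at most
`N`. The positivity clause of `InList` keeps the list empty when `(u, v)` has probability zero. -/
theorem prob_inList_le [Fintype B] {q : Ω → ℝ} (hq : ∀ ω, 0 ≤ q ω) (Y : Ω → B) (U : Ω → C) (V : Ω → D) {N : ℝ}
    (hN : 0 ≤ N) (u : C) (v : D) : prob (fun _ => 1) (InList q Y U V N u v) ≤ N := by
  classical
  by_cases h0 : 0 < law q (fun ω => (U ω, V ω)) (u, v)
  · have h : prob (fun _ => 1) (InList q Y U V N u v) * law q (fun ω => (U ω, V ω)) (u, v) ≤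
        N * law q (fun ω => (U ω, V ω)) (u, v) := by
      rw [← prob_mul_const]
      refine le_trans ?_ (le_of_eq (congrArg (N * ·)
        (sum_law_pair_left q Y (fun ω => (U ω, V ω)) (u, v))))
      rw [Finset.mul_sum]
      refine Finset.sum_le_sum fun y _ => ?_
      split_ifs with hy
      · rw [one_mul]; exact hy.2
      · exact mul_nonneg hN (law_nonneg hq _ _)
    exact le_of_mul_le_mul_right h h0
  · refine le_trans (le_of_eq ?_) hN
    unfold prob
    refine Finset.sum_eq_zero fun y _ => ?_
    rw [if_neg]
    exact fun h => h0 h.1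

variable [Fintype A] [Fintype B] [Fintype D]

/-- The list misses `Y` with probability at most `δ ^ 3`, so by Markov's inequality its conditional
miss probability exceeds `δ` with probability at most `δ ^ 2`. -/
theorem prob_not_refinementSuits_le [Fintype C] {q : Ω → ℝ} (hq : ∀ ω, 0 ≤ q ω) (X : Ω → A) (Y : Ω → B)
    (U : Ω → C) (V : Ω → D) (hM : IsMarkovChain q Y X fun ω => (U ω, V ω)) {Γ N δ : ℝ}
    (hδ : 0 < δ)
    (hΓ : prob q (fun ω => Γ * (law q (fun ω => (X ω, U ω)) (X ω, U ω) *
      law q (fun ω => (V ω, U ω)) (V ω, U ω)) <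
        law q (fun ω => ((X ω, U ω), V ω)) ((X ω, U ω), V ω) * law q U (U ω)) ≤ δ ^ 3)
    (hN : prob q (fun ω => N * law q (fun ω => (Y ω, U ω, V ω)) (Y ω, U ω, V ω) <
      law q (fun ω => (U ω, V ω)) (U ω, V ω)) ≤ δ ^ 3) :
    prob q (fun ω => ¬ RefinementSuits q X Y U V Γ N δ (X ω) (U ω) (V ω)) ≤ δ ^ 3 + δ ^ 2 := by
  have hcond := prob_condProb_gt_le hq (fun ω => (X ω, U ω, V ω)) Y
    (fun a y => ¬ InList q Y U V N a.2.1 a.2.2 y) δ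
  have hlist : prob q (fun ω => ¬ InList q Y U V N (U ω) (V ω) (Y ω)) ≤ δ ^ 3 := by
    refine (prob_mono hq fun ω hω h => ?_).trans hN
    by_contra hle
    exact h ⟨law_pos hq (fun ω => (U ω, V ω)) hω, not_lt.mp hle⟩
  have hcond' : prob q (fun ω => δ * law q X (X ω) <
      prob (fun y => law q (fun ω => (Y ω, X ω)) (y, X ω))
        (fun y => ¬ InList q Y U V N (U ω) (V ω) y)) ≤ δ ^ 2 := by
    refine le_of_mul_le_mul_left (le_trans ?_ ((hcond.trans hlist).trans
      (le_of_eq (by ring : δ ^ 3 = δ * δ ^ 2)))) hδ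
    refine mul_le_mul_of_nonneg_left (prob_mono hq fun ω hω h => ?_) hδ.le
    have hX := law_pos hq X hω
    have hXUV := law_pos hq (fun ω => (X ω, U ω, V ω)) hω
    -- By the Markov chain, conditioning `Y` on `(X, U, V)` is the same as conditioning it on `X`.
    have heq : prob (fun y => law q (fun ω => ((X ω, U ω, V ω), Y ω)) ((X ω, U ω, V ω), y))
          (fun y => ¬ InList q Y U V N (U ω) (V ω) y) * law q X (X ω) =
        prob (fun y => law q (fun ω => (Y ω, X ω)) (y, X ω))
          (fun y => ¬ InList q Y U V N (U ω) (V ω) y) *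
            law q (fun ω => (X ω, U ω, V ω)) (X ω, U ω, V ω) := by
      rw [← prob_mul_const, ← prob_mul_const]
      refine prob_eq_prob_mass _ fun y => ?_
      rw [← hM y (X ω) (U ω, V ω)]
      congr 1
      exact law_congr q fun ω' => by simp [and_comm]
    refine lt_of_mul_lt_mul_right ?_ hX.le
    rw [heq]
    nlinarith
  refine le_trans (prob_mono hq fun ω _ h => ?_) ((prob_or_le hq _ _).trans (add_le_add hΓ hcond'))
  by_contra hnot
  rw [not_or, not_lt, not_lt] at hnot
  exact h hnot

/-- A second use of Markov's inequality, now given `(X, U)`, costs another factor `δ`; this is why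
the hypotheses carry `δ ^ 3`. -/
theorem prob_not_refinable_le [Fintype C] {q : Ω → ℝ} (hq : ∀ ω, 0 ≤ q ω) (X : Ω → A) (Y : Ω → B)
    (U : Ω → C) (V : Ω → D) (hM : IsMarkovChain q Y X fun ω => (U ω, V ω)) {Γ N δ : ℝ}
    (hδ : 0 < δ) (hδ1 : δ ≤ 1)
    (hΓ : prob q (fun ω => Γ * (law q (fun ω => (X ω, U ω)) (X ω, U ω) *
      law q (fun ω => (V ω, U ω)) (V ω, U ω)) <
        law q (fun ω => ((X ω, U ω), V ω)) ((X ω, U ω), V ω) * law q U (U ω)) ≤ δ ^ 3)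
    (hN : prob q (fun ω => N * law q (fun ω => (Y ω, U ω, V ω)) (Y ω, U ω, V ω) <
      law q (fun ω => (U ω, V ω)) (U ω, V ω)) ≤ δ ^ 3) :
    prob q (fun ω => ¬ Refinable q X Y U V Γ N δ (X ω) (U ω)) ≤ 2 * δ := by
  have hcond := prob_condProb_gt_le hq (fun ω => (X ω, U ω)) V
    (fun a v => ¬ RefinementSuits q X Y U V Γ N δ a.1 a.2 v) δ
  have h := hcond.trans (prob_not_refinementSuits_le hq X Y U V hM hδ hΓ hN)
  refine le_of_mul_le_mul_left (le_trans ?_ (h.trans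
    (by nlinarith [pow_pos hδ 2] : δ ^ 3 + δ ^ 2 ≤ δ * (2 * δ)))) hδ
  exact mul_le_mul_of_nonneg_left (prob_mono hq fun ω _ h => not_le.mp h) hδ.le

/-- Codebooks for the refinement, one for each index of the base description. -/
theorem exists_refinement_codebooks {q : Ω → ℝ} (hq : q ∈ stdSimplex ℝ Ω) (X : Ω → A) (Y : Ω → B)
    (U : Ω → C) (V : Ω → D) {Γ N δ : ℝ} (hΓ : 0 < Γ) (hδ : 0 < δ) {M₀ M : ℕ}
    (hM : Real.exp (-(M / Γ)) ≤ δ) (c₀ : Fin M₀ → C) (φ₀ : A → Fin M₀) (P : A → C → Prop)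
    (hP : ∀ x u, P x u → 0 < law q (fun ω => (X ω, U ω)) (x, u) ∧
      Refinable q X Y U V Γ N δ x u) :
    ∃ c : Fin M₀ → Fin M → D, prob (law q X) (fun x => P x (c₀ (φ₀ x)) ∧
      ∀ m, ¬ RefinementSuits q X Y U V Γ N δ x (c₀ (φ₀ x)) (c (φ₀ x) m)) ≤ 2 * δ := by
  classical
  obtain ⟨ω₀⟩ : Nonempty Ω := by
    by_contra hne
    rw [not_nonempty_iff] at hne
    simpa using hq.2
  have : Nonempty D := ⟨V ω₀⟩
  -- The law of `X` restricted to the inputs sent to base index `m` with success. Each `m` is a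
  -- separate covering problem, and the weights over all `m` sum to at most `law q X x`.
  set w : Fin M₀ → A → ℝ := fun m x => if φ₀ x = m ∧ P x (c₀ m) then law q X x else 0
  have hw0 : ∀ m x, 0 ≤ w m x := fun m x => by
    simp only [w]; split_ifs
    · exact law_nonneg hq.1 _ _
    · exact le_rfl
  have hwP : ∀ m x, w m x ≠ 0 → P x (c₀ m) := fun m x h => by
    by_contra hne
    exact h (if_neg fun h' => hne h'.2)
  have hex : ∀ m, ∃ c : Fin M → D,
      prob (w m) (fun x => ∀ j, ¬ RefinementSuits q X Y U V Γ N δ x (c₀ m) (c j)) ≤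
        ∑ x, w m x * (2 * δ) := by
    intro m
    have hUpos : ∀ x, w m x ≠ 0 → 0 < law q U (c₀ m) := fun x hx =>
      (hP x _ (hwP m x hx)).1.trans_le (law_le_law hq.1 fun ω h => (Prod.mk.inj h).2)
    obtain ⟨c, hc⟩ := exists_covering_codebook (w := w m) (hw0 m)
      (r := fun v => law q (fun ω => (V ω, U ω)) (v, c₀ m) / law q U (c₀ m))
      (fun v => div_nonneg (law_nonneg hq.1 _ _) (law_nonneg hq.1 _ _))
      (fun x v => law q (fun ω => ((X ω, U ω), V ω)) ((x, c₀ m), v) /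
        law q (fun ω => (X ω, U ω)) (x, c₀ m))
      (fun x v => div_nonneg (law_nonneg hq.1 _ _) (law_nonneg hq.1 _ _))
      (fun x v => RefinementSuits q X Y U V Γ N δ x (c₀ m) v) hΓ
      (fun x hx => by
        rw [← Finset.sum_div, sum_law_pair_left, div_self (hUpos x hx).ne'])
      (fun x hx => by
        rw [← Finset.sum_div, sum_law_pair_right, div_self (hP x _ (hwP m x hx)).1.ne'])
      (fun x v hx hs => by
        rw [div_le_iff₀ (hP x _ (hwP m x hx)).1, ← mul_div_assoc, div_mul_eq_mul_div,
          le_div_iff₀ (hUpos x hx)]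
        refine hs.1.trans (le_of_eq ?_)
        ring) M
    refine ⟨c, hc.trans (Finset.sum_le_sum fun x _ => ?_)⟩
    by_cases hx : w m x = 0
    · simp [hx]
    refine mul_le_mul_of_nonneg_left ?_ (hw0 m x)
    obtain ⟨hpos, href⟩ := hP x _ (hwP m x hx)
    have : prob (fun v => law q (fun ω => ((X ω, U ω), V ω)) ((x, c₀ m), v) /
        law q (fun ω => (X ω, U ω)) (x, c₀ m))
        (fun v => ¬ RefinementSuits q X Y U V Γ N δ x (c₀ m) v) ≤ δ := by
      simp only [div_eq_mul_inv]
      rw [prob_mul_const, ← div_eq_mul_inv, div_le_iff₀ hpos]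
      exact href
    linarith
  choose c hc using hex
  refine ⟨c, ?_⟩
  calc _ = ∑ m, prob (w m) (fun x => ∀ j, ¬ RefinementSuits q X Y U V Γ N δ x (c₀ m) (c m j)) := by
        unfold prob
        rw [Finset.sum_comm]
        refine Finset.sum_congr rfl fun x _ => ?_
        rw [Finset.sum_eq_single (φ₀ x)]
        · simp only [w, true_and]
          by_cases h1 : P x (c₀ (φ₀ x)) <;>
            by_cases h2 : ∀ m, ¬ RefinementSuits q X Y U V Γ N δ x (c₀ (φ₀ x)) (c (φ₀ x) m) <;>
            simp [h1, h2]
        · intro m _ hm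
          simp [w, hm.symm]
        · simp
    _ ≤ ∑ m, ∑ x, w m x * (2 * δ) := Finset.sum_le_sum fun m _ => hc m
    _ ≤ ∑ x, law q X x * (2 * δ) := by
        rw [Finset.sum_comm]
        refine Finset.sum_le_sum fun x _ => ?_
        rw [← Finset.sum_mul]
        refine mul_le_mul_of_nonneg_right ?_ (by linarith)
        rw [Finset.sum_eq_single (φ₀ x)]
        · simp only [w, true_and]
          split_ifs
          · exact le_rfl
          · exact law_nonneg hq.1 _ _
        · intro m _ hm
          simp [w, hm.symm]
        · simp
    _ = 2 * δ := by rw [← Finset.sum_mul, sum_law, hq.2, one_mul]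

/-- The refinement encoder, the bins and the decoder for one sink, given the base description. -/
theorem exists_sink_code {q : Ω → ℝ} (hq : q ∈ stdSimplex ℝ Ω) (X : Ω → A) (Y : Ω → B)
    (U : Ω → C) (V : Ω → D) {Γ N δ : ℝ} (hΓ : 0 < Γ) (hN : 0 ≤ N) (hδ : 0 < δ) {M₀ M L : ℕ}
    (hM0 : 0 < M) (hM : Real.exp (-(M / Γ)) ≤ δ) (hL : 0 < L) (hNL : N ≤ δ * L)
    (c₀ : Fin M₀ → C) (φ₀ : A → Fin M₀) (P : A → C → Prop)
    (hP : ∀ x u, P x u → 0 < law q (fun ω => (X ω, U ω)) (x, u) ∧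
      Refinable q X Y U V Γ N δ x u) :
    ∃ (φ : A → Fin M) (b : B → Fin L) (d : Fin M₀ × Fin M × Fin L → B),
      prob q (fun ω => Y ω ≠ d (φ₀ (X ω), φ (X ω), b (Y ω))) ≤
        prob q (fun ω => ¬ P (X ω) (c₀ (φ₀ (X ω)))) + 4 * δ := by
  classical
  obtain ⟨ω₀⟩ : Nonempty Ω := by
    by_contra hne
    rw [not_nonempty_iff] at hne
    simpa using hq.2
  obtain ⟨c, hc⟩ := exists_refinement_codebooks hq X Y U V hΓ hδ hM c₀ φ₀ P hP
  have hφ : ∃ φ : A → Fin M, ∀ x m,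
      RefinementSuits q X Y U V Γ N δ x (c₀ (φ₀ x)) (c (φ₀ x) m) →
      RefinementSuits q X Y U V Γ N δ x (c₀ (φ₀ x)) (c (φ₀ x) (φ x)) := by
    have : ∀ x, ∃ m', ∀ m, RefinementSuits q X Y U V Γ N δ x (c₀ (φ₀ x)) (c (φ₀ x) m) →
        RefinementSuits q X Y U V Γ N δ x (c₀ (φ₀ x)) (c (φ₀ x) m') := by
      intro x
      by_cases h : ∃ m, RefinementSuits q X Y U V Γ N δ x (c₀ (φ₀ x)) (c (φ₀ x) m)
      · obtain ⟨m, hm⟩ := h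
        exact ⟨m, fun _ _ => hm⟩
      · exact ⟨⟨0, hM0⟩, fun m hm => (h ⟨m, hm⟩).elim⟩
    choose φ hφ using this
    exact ⟨φ, hφ⟩
  obtain ⟨φ, hφ⟩ := hφ
  obtain ⟨b, hb⟩ := exists_binning hq Y (fun ω => (φ₀ (X ω), φ (X ω)))
    (fun s => InList q Y U V N (c₀ s.1) (c s.1 s.2))
    (fun s => prob_inList_le hq.1 Y U V hN _ _) hL
  let d : Fin M₀ × Fin M × Fin L → B := fun s =>
    if h : ∃ y, b y = s.2.2 ∧ InList q Y U V N (c₀ s.1) (c s.1 s.2.1) y then h.choose else Y ω₀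
  refine ⟨φ, b, d, ?_⟩
  have hb' := hb.trans ((div_le_iff₀ (by exact_mod_cast hL : (0 : ℝ) < L)).mpr hNL)
  -- The chosen codewords are functions of `X`, so the list-miss clause of `RefinementSuits` applies
  -- for each value of `X` and can be averaged.
  have hmiss : prob q (fun ω =>
      RefinementSuits q X Y U V Γ N δ (X ω) (c₀ (φ₀ (X ω))) (c (φ₀ (X ω)) (φ (X ω))) ∧
        ¬ InList q Y U V N (c₀ (φ₀ (X ω))) (c (φ₀ (X ω)) (φ (X ω))) (Y ω)) ≤ δ := by
    rw [← prob_law q (fun ω => (Y ω, X ω)) fun a =>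
      RefinementSuits q X Y U V Γ N δ a.2 (c₀ (φ₀ a.2)) (c (φ₀ a.2) (φ a.2)) ∧
        ¬ InList q Y U V N (c₀ (φ₀ a.2)) (c (φ₀ a.2) (φ a.2)) a.1]
    unfold prob
    rw [Fintype.sum_prod_type_right]
    calc _ ≤ ∑ x, δ * law q X x := by
          refine Finset.sum_le_sum fun x _ => ?_
          by_cases hs : RefinementSuits q X Y U V Γ N δ x (c₀ (φ₀ x)) (c (φ₀ x) (φ x))
          · refine le_trans (le_of_eq ?_) hs.2
            unfold prob
            simp only [hs, true_and]
          · simp only [hs, false_and, if_false, Finset.sum_const_zero]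
            exact mul_nonneg hδ.le (law_nonneg hq.1 _ _)
      _ = δ := by rw [← Finset.mul_sum, sum_law, hq.2, mul_one]
  rw [prob_law q X fun x => P x (c₀ (φ₀ x)) ∧
      ∀ m, ¬ RefinementSuits q X Y U V Γ N δ x (c₀ (φ₀ x)) (c (φ₀ x) m)] at hc
  -- Four error events: the base codeword fails, no refinement suits (`2 * δ`), the list misses `Y`
  -- (`δ`), a wrong list element shares the bin (`δ`).
  have hsum := add_le_add (le_refl (prob q (fun ω => ¬ P (X ω) (c₀ (φ₀ (X ω))))))
    (add_le_add hc (add_le_add hmiss hb'))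
  refine le_trans ?_ (hsum.trans (le_of_eq (by ring)))
  refine le_trans (prob_mono hq.1 fun ω _ herr => ?_) ((prob_or_le hq.1 _ _).trans
    (add_le_add le_rfl ((prob_or_le hq.1 _ _).trans (add_le_add le_rfl (prob_or_le hq.1 _ _)))))
  by_contra hnot
  simp only [not_or, not_not, not_and, not_forall, not_exists] at hnot
  obtain ⟨h1, h2, h3, h4⟩ := hnot
  obtain ⟨m, hm⟩ := h2 h1
  have hin := h3 (hφ _ m hm)
  apply herr
  have hex : ∃ y, b y = b (Y ω) ∧ InList q Y U V N (c₀ (φ₀ (X ω))) (c (φ₀ (X ω)) (φ (X ω))) y :=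
    ⟨Y ω, rfl, hin⟩
  have hd : d (φ₀ (X ω), φ (X ω), b (Y ω)) = hex.choose := dif_pos hex
  rw [hd]
  by_contra hne
  exact h4 hex.choose (fun h => hne h.symm) hex.choose_spec.1 hex.choose_spec.2

/-- One-shot achievability for the two-sink helper network. -/
theorem exists_oneShot_code [Fintype C] {B₁ B₂ D₁ D₂ : Type*} [Fintype B₁] [Fintype B₂] [Fintype D₁]
    [Fintype D₂] {q : Ω → ℝ} (hq : q ∈ stdSimplex ℝ Ω) (X : Ω → A) (Y₁ : Ω → B₁) (Y₂ : Ω → B₂)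
    (U : Ω → C) (V₁ : Ω → D₁) (V₂ : Ω → D₂)
    (hK₁ : IsMarkovChain q Y₁ X fun ω => (U ω, V₁ ω))
    (hK₂ : IsMarkovChain q Y₂ X fun ω => (U ω, V₂ ω)) {Γ₀ Γ₁ Γ₂ N₁ N₂ δ : ℝ}
    (hΓ₀ : 0 < Γ₀) (hΓ₁ : 0 < Γ₁) (hΓ₂ : 0 < Γ₂) (hN₁ : 0 ≤ N₁) (hN₂ : 0 ≤ N₂)
    (hδ : 0 < δ) (hδ1 : δ ≤ 1) {M₀ M₁ M₂ L₁ L₂ : ℕ}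
    (hM₀0 : 0 < M₀) (hM₁0 : 0 < M₁) (hM₂0 : 0 < M₂) (hL₁0 : 0 < L₁) (hL₂0 : 0 < L₂)
    (hM₀ : Real.exp (-(M₀ / Γ₀)) ≤ δ) (hM₁ : Real.exp (-(M₁ / Γ₁)) ≤ δ)
    (hM₂ : Real.exp (-(M₂ / Γ₂)) ≤ δ) (hL₁ : N₁ ≤ δ * L₁) (hL₂ : N₂ ≤ δ * L₂)
    (hX : prob q (fun ω => Γ₀ * (law q X (X ω) * law q U (U ω)) <
      law q (fun ω => (X ω, U ω)) (X ω, U ω)) ≤ δ ^ 3)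
    (hV₁ : prob q (fun ω => Γ₁ * (law q (fun ω => (X ω, U ω)) (X ω, U ω) *
      law q (fun ω => (V₁ ω, U ω)) (V₁ ω, U ω)) <
        law q (fun ω => ((X ω, U ω), V₁ ω)) ((X ω, U ω), V₁ ω) * law q U (U ω)) ≤ δ ^ 3)
    (hV₂ : prob q (fun ω => Γ₂ * (law q (fun ω => (X ω, U ω)) (X ω, U ω) *
      law q (fun ω => (V₂ ω, U ω)) (V₂ ω, U ω)) <
        law q (fun ω => ((X ω, U ω), V₂ ω)) ((X ω, U ω), V₂ ω) * law q U (U ω)) ≤ δ ^ 3)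
    (hY₁ : prob q (fun ω => N₁ * law q (fun ω => (Y₁ ω, U ω, V₁ ω)) (Y₁ ω, U ω, V₁ ω) <
      law q (fun ω => (U ω, V₁ ω)) (U ω, V₁ ω)) ≤ δ ^ 3)
    (hY₂ : prob q (fun ω => N₂ * law q (fun ω => (Y₂ ω, U ω, V₂ ω)) (Y₂ ω, U ω, V₂ ω) <
      law q (fun ω => (U ω, V₂ ω)) (U ω, V₂ ω)) ≤ δ ^ 3) :
    ∃ (φ₀ : A → Fin M₀) (φ₁ : A → Fin M₁) (φ₂ : A → Fin M₂) (b₁ : B₁ → Fin L₁)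
      (b₂ : B₂ → Fin L₂) (d₁ : Fin M₀ × Fin M₁ × Fin L₁ → B₁)
      (d₂ : Fin M₀ × Fin M₂ × Fin L₂ → B₂),
      prob q (fun ω => Y₁ ω ≠ d₁ (φ₀ (X ω), φ₁ (X ω), b₁ (Y₁ ω))) ≤ 10 * δ ∧
      prob q (fun ω => Y₂ ω ≠ d₂ (φ₀ (X ω), φ₂ (X ω), b₂ (Y₂ ω))) ≤ 10 * δ := by
  classical
  obtain ⟨ω₀⟩ : Nonempty Ω := by
    by_contra hne
    rw [not_nonempty_iff] at hne
    simpa using hq.2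
  have : Nonempty C := ⟨U ω₀⟩
  -- One base codeword serves both sinks, so `P` demands good refinements for both; its first clause
  -- makes conditioning on `(x, u)` legitimate.
  set P : A → C → Prop := fun x u => 0 < law q (fun ω => (X ω, U ω)) (x, u) ∧
    law q (fun ω => (X ω, U ω)) (x, u) ≤ Γ₀ * (law q X x * law q U u) ∧
    Refinable q X Y₁ U V₁ Γ₁ N₁ δ x u ∧ Refinable q X Y₂ U V₂ Γ₂ N₂ δ x u with hPdef
  have hPprob : prob q (fun ω => ¬ P (X ω) (U ω)) ≤ 5 * δ := by
    have h1 := prob_not_refinable_le hq.1 X Y₁ U V₁ hK₁ hδ hδ1 hV₁ hY₁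
    have h2 := prob_not_refinable_le hq.1 X Y₂ U V₂ hK₂ hδ hδ1 hV₂ hY₂
    have h3 : δ ^ 3 ≤ δ := by
      have := pow_le_pow_of_le_one hδ.le hδ1 (by norm_num : 1 ≤ 3)
      simpa using this
    refine le_trans (prob_mono hq.1 fun ω hω h => ?_) (((prob_or_le hq.1 _ _).trans
      (add_le_add (hX.trans h3) ((prob_or_le hq.1 _ _).trans (add_le_add h1 h2)))).trans
      (le_of_eq (by ring)))
    by_contra hnot
    simp only [not_or, not_not, not_lt] at hnot
    exact h ⟨law_pos hq.1 (fun ω => (X ω, U ω)) hω, hnot⟩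
  obtain ⟨c₀, hc₀⟩ := exists_covering_codebook (w := law q X) (law_nonneg hq.1 X)
    (r := law q U) (law_nonneg hq.1 U)
    (fun x u => law q (fun ω => (X ω, U ω)) (x, u) / law q X x)
    (fun x u => div_nonneg (law_nonneg hq.1 _ _) (law_nonneg hq.1 _ _)) P hΓ₀
    (fun _ _ => by rw [sum_law, hq.2])
    (fun x hx => by rw [← Finset.sum_div, sum_law_pair_right, div_self hx])
    (fun x u hx hP => by
      rw [div_le_iff₀ ((law_nonneg hq.1 X x).lt_of_ne' hx)]
      exact hP.2.1.trans (le_of_eq (by ring))) M₀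
  have hφ : ∀ x, ∃ m', ∀ m, P x (c₀ m) → P x (c₀ m') := by
    intro x
    by_cases h : ∃ m, P x (c₀ m)
    · obtain ⟨m, hm⟩ := h
      exact ⟨m, fun _ _ => hm⟩
    · exact ⟨⟨0, hM₀0⟩, fun m hm => (h ⟨m, hm⟩).elim⟩
  choose φ₀ hφ₀ using hφ
  -- The base covering adds `δ` to the `5 * δ` of `hPprob`; with the `4 * δ` of `exists_sink_code`
  -- each sink errs with probability at most `10 * δ`.
  have hfail : prob q (fun ω => ¬ P (X ω) (c₀ (φ₀ (X ω)))) ≤ 6 * δ := by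
    rw [← prob_law q X fun x => ¬ P x (c₀ (φ₀ x))]
    calc _ ≤ prob (law q X) fun x => ∀ m, ¬ P x (c₀ m) :=
          prob_mono (law_nonneg hq.1 X) fun x _ h m hm => h (hφ₀ x m hm)
      _ ≤ _ := hc₀
      _ ≤ ∑ x, (prob (fun u => law q (fun ω => (X ω, U ω)) (x, u)) (fun u => ¬ P x u) +
            law q X x * δ) := by
          refine Finset.sum_le_sum fun x _ => ?_
          rw [mul_add]
          refine add_le_add ?_ (mul_le_mul_of_nonneg_left hM₀ (law_nonneg hq.1 _ _))
          rw [mul_comm, ← prob_mul_const]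
          by_cases hx : law q X x = 0
          · simp only [hx, mul_zero]
            refine le_trans (le_of_eq ?_) (prob_nonneg (fun u => law_nonneg hq.1 _ _) _)
            simp [prob]
          · exact le_of_eq (prob_eq_prob_mass _ fun u => div_mul_cancel₀ _ hx)
      _ = prob q (fun ω => ¬ P (X ω) (U ω)) + δ := by
          rw [Finset.sum_add_distrib, ← Finset.sum_mul, sum_law, hq.2, one_mul,
            ← prob_law q (fun ω => (X ω, U ω)) fun a => ¬ P a.1 a.2,
            prob_prod (law q fun ω => (X ω, U ω)) fun x u => ¬ P x u]
      _ ≤ 6 * δ := by linarith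
  obtain ⟨φ₁, b₁, d₁, h₁⟩ := exists_sink_code hq X Y₁ U V₁ hΓ₁ hN₁ hδ hM₁0 hM₁ hL₁0 hL₁ c₀ φ₀ P
    fun x u h => ⟨h.1, h.2.2.1⟩
  obtain ⟨φ₂, b₂, d₂, h₂⟩ := exists_sink_code hq X Y₂ U V₂ hΓ₂ hN₂ hδ hM₂0 hM₂ hL₂0 hL₂ c₀ φ₀ P
    fun x u h => ⟨h.1, h.2.2.2⟩
  exact ⟨φ₀, φ₁, φ₂, b₁, b₂, d₁, d₂, by linarith, by linarith⟩

end OneShot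

/-! ### Achievability -/

section Asymptotics

open Filter Topology

variable {Ω A B C D : Type*} [Fintype Ω]

/-- The weak law of large numbers in multiplicative form, by Chernoff's bound. -/
theorem tendsto_prob_prod_gt {q : Ω → ℝ} (hq : q ∈ stdSimplex ℝ Ω) {F : Ω → ℝ}
    (hF : ∀ ω, 0 < q ω → 0 < F ω) {η : ℝ} (hη : 0 < η) :
    Tendsto (fun n : ℕ => prob (iidMass n q) fun x =>
      (2 : ℝ) ^ (n * ((∑ ω, q ω * Real.logb 2 (F ω)) + η)) < ∏ i, F (x i)) atTop (𝓝 0) := by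
  classical
  set e := ∑ ω, q ω * Real.logb 2 (F ω) with he
  set f : Ω → ℝ := fun ω => Real.logb 2 (F ω) - (e + η) with hf
  -- The moment generating function of `log₂ F - (e + η)`, whose mean is `-η`. As `φ 0 = 1` and `φ'
  -- 0 = -η < 0`, some `s > 0` has `φ s < 1`, and the probability is at most `φ s ^ n`.
  set φ : ℝ → ℝ := fun s => ∑ ω, q ω * Real.exp (s * f ω) with hφ
  have hφ0 : φ 0 = 1 := by simp [hφ, hq.2]
  have hφnn : ∀ s, 0 ≤ φ s := fun s =>
    Finset.sum_nonneg fun ω _ => mul_nonneg (hq.1 ω) (Real.exp_pos _).le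
  have hderiv : HasDerivAt φ (-η) 0 := by
    have h1 : HasDerivAt φ (∑ ω, q ω * (Real.exp (0 * f ω) * (1 * f ω))) 0 :=
      HasDerivAt.fun_sum fun ω _ => (((hasDerivAt_id (0 : ℝ)).mul_const (f ω)).exp).const_mul (q ω)
    convert h1 using 1
    simp only [zero_mul, Real.exp_zero, one_mul]
    simp only [hf, mul_sub, Finset.sum_sub_distrib,
      ← Finset.sum_mul, hq.2]
    linarith
  obtain ⟨s, hs, hs1⟩ : ∃ s, 0 < s ∧ φ s < 1 := by
    have h1 := (hasDerivAt_iff_tendsto_slope.mp hderiv).eventually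
      (gt_mem_nhds (neg_lt_zero.mpr hη))
    have h2 : ∀ᶠ s in 𝓝[>] (0 : ℝ), slope φ 0 s < 0 :=
      h1.filter_mono (nhdsWithin_mono _ fun s hs => ne_of_gt hs)
    obtain ⟨s, hslope, hs⟩ := (h2.and self_mem_nhdsWithin).exists
    refine ⟨s, hs, ?_⟩
    have hs' : (0 : ℝ) < s := hs
    rw [slope_def_field, hφ0, sub_zero, div_lt_iff₀ hs', zero_mul] at hslope
    linarith
  refine squeeze_zero (fun n => prob_nonneg (iidMass_mem_stdSimplex n hq).1 _) (fun n => ?_)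
    (tendsto_pow_atTop_nhds_zero_of_lt_one (hφnn s) hs1)
  have hprod := sum_iidMass_mul_prod n q fun _ ω => Real.exp (s * f ω)
  rw [Finset.prod_const, Finset.card_univ, Fintype.card_fin] at hprod
  rw [← show ∑ x, iidMass n q x * ∏ i, Real.exp (s * f (x i)) = φ s ^ n from hprod,
    prob_eq_sum_mul]
  refine sum_mul_le_sum_mul_of_pos (iidMass_mem_stdSimplex n hq).1 fun x hx => ?_
  split_ifs with h
  · have hpos : ∀ i, 0 < F (x i) := fun i => hF _ (pos_of_iidMass_pos hq.1 hx i)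
    rw [← Real.exp_sum, ← Finset.mul_sum, Real.one_le_exp_iff]
    refine mul_nonneg hs.le ?_
    have hlog := Real.logb_lt_logb one_lt_two (by positivity) h
    rw [Real.logb_rpow two_pos (by norm_num), Real.logb_prod _ _ fun i _ => (hpos i).ne'] at hlog
    simp only [hf, Finset.sum_sub_distrib, Finset.sum_const, Finset.card_univ, Fintype.card_fin,
      nsmul_eq_mul]
    linarith
  · exact Finset.prod_nonneg fun i _ => (Real.exp_pos _).le

theorem law_iidMass_comp (n : ℕ) (q : Ω → ℝ) (X : Ω → A) (a : Fin n → A) :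
    law (iidMass n q) (fun x j => X (x j)) a = ∏ j, law q X (a j) :=
  law_iidMass n q (fun _ => X) a

theorem law_iidMass_pair (n : ℕ) (q : Ω → ℝ) (X : Ω → A) (Y : Ω → B) (a : Fin n → A)
    (b : Fin n → B) :
    law (iidMass n q) (fun x => ((fun j => X (x j)), fun j => Y (x j))) (a, b) =
      ∏ j, law q (fun ω => (X ω, Y ω)) (a j, b j) := by
  rw [← law_iidMass_comp n q (fun ω => (X ω, Y ω)) fun j => (a j, b j)]
  exact law_congr _ fun x => by simp [funext_iff, forall_and]

theorem law_iidMass_triple (n : ℕ) (q : Ω → ℝ) (X : Ω → A) (Y : Ω → B) (Z : Ω → C)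
    (a : Fin n → A) (b : Fin n → B) (c : Fin n → C) :
    law (iidMass n q) (fun x => ((fun j => X (x j)), (fun j => Y (x j)), fun j => Z (x j)))
      (a, b, c) = ∏ j, law q (fun ω => (X ω, Y ω, Z ω)) (a j, b j, c j) := by
  rw [← law_iidMass_comp n q (fun ω => (X ω, Y ω, Z ω)) fun j => (a j, b j, c j)]
  exact law_congr _ fun x => by simp [funext_iff, forall_and]

theorem IsMarkovChain.iid {q : Ω → ℝ} {X : Ω → A} {Y : Ω → B} {U : Ω → C} {V : Ω → D}
    (h : IsMarkovChain q X Y fun ω => (U ω, V ω)) (n : ℕ) :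
    IsMarkovChain (iidMass n q) (fun x j => X (x j)) (fun x j => Y (x j))
      fun x => ((fun j => U (x j)), fun j => V (x j)) := by
  rintro a b ⟨c, d⟩
  rw [law_iidMass_pair, law_iidMass_triple, law_iidMass_comp,
    law_congr _ (X := fun x : Fin n → Ω => ((fun j => X (x j)), (fun j => Y (x j)),
      (fun j => U (x j)), fun j => V (x j)))
      (Y := fun x j => (X (x j), Y (x j), U (x j), V (x j)))
      (b := fun j => (a j, b j, c j, d j)) fun x => by simp [funext_iff, forall_and],
    law_iidMass_comp n q (fun ω => (X ω, Y ω, U ω, V ω)),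
    ← Finset.prod_mul_distrib, ← Finset.prod_mul_distrib]
  exact Finset.prod_congr rfl fun j _ => h (a j) (b j) (c j, d j)

theorem tendsto_prob_mutualInfo [Fintype A] [Fintype B] {q : Ω → ℝ} (hq : q ∈ stdSimplex ℝ Ω)
    (X : Ω → A) (U : Ω → B) {η : ℝ} (hη : 0 < η) :
    Tendsto (fun n : ℕ => prob (iidMass n q) fun ω =>
      (2 : ℝ) ^ (n * (mutualInfo q X U + η)) *
        (law (iidMass n q) (fun x j => X (x j)) (fun j => X (ω j)) *
          law (iidMass n q) (fun x j => U (x j)) (fun j => U (ω j))) <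
        law (iidMass n q) (fun x => ((fun j => X (x j)), fun j => U (x j)))
          ((fun j => X (ω j)), fun j => U (ω j))) atTop (𝓝 0) := by
  rw [mutualInfo_eq_sum]
  refine squeeze_zero (fun n => prob_nonneg (iidMass_mem_stdSimplex n hq).1 _) (fun n => ?_)
    (tendsto_prob_prod_gt hq (F := fun ω => law q (fun ω => (X ω, U ω)) (X ω, U ω) /
      (law q X (X ω) * law q U (U ω))) (fun ω h => ?_) hη)
  · refine prob_mono (iidMass_mem_stdSimplex n hq).1 fun x hx h => ?_
    have hp := fun j => pos_of_iidMass_pos hq.1 hx j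
    rw [law_iidMass_pair, law_iidMass_comp, law_iidMass_comp] at h
    rw [Finset.prod_div_distrib, Finset.prod_mul_distrib, lt_div_iff₀]
    · exact h
    · exact mul_pos (Finset.prod_pos fun j _ => law_pos hq.1 X (hp j))
        (Finset.prod_pos fun j _ => law_pos hq.1 U (hp j))
  · exact div_pos (law_pos hq.1 (fun ω => (X ω, U ω)) h)
      (mul_pos (law_pos hq.1 X h) (law_pos hq.1 U h))

theorem tendsto_prob_condMutualInfo [Fintype A] [Fintype B] [Fintype C] {q : Ω → ℝ}
    (hq : q ∈ stdSimplex ℝ Ω) (X : Ω → A) (V : Ω → B) (U : Ω → C) {η : ℝ} (hη : 0 < η) :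
    Tendsto (fun n : ℕ => prob (iidMass n q) fun ω =>
      (2 : ℝ) ^ (n * (condMutualInfo q X V U + η)) *
        (law (iidMass n q) (fun x => ((fun j => X (x j)), fun j => U (x j)))
          ((fun j => X (ω j)), fun j => U (ω j)) *
          law (iidMass n q) (fun x => ((fun j => V (x j)), fun j => U (x j)))
            ((fun j => V (ω j)), fun j => U (ω j))) <
        law (iidMass n q) (fun x => (((fun j => X (x j)), fun j => U (x j)), fun j => V (x j)))
          (((fun j => X (ω j)), fun j => U (ω j)), fun j => V (ω j)) *
          law (iidMass n q) (fun x j => U (x j)) (fun j => U (ω j))) atTop (𝓝 0) := by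
  rw [condMutualInfo_eq_sum]
  refine squeeze_zero (fun n => prob_nonneg (iidMass_mem_stdSimplex n hq).1 _) (fun n => ?_)
    (tendsto_prob_prod_gt hq (F := fun ω =>
      (law q (fun ω => (X ω, V ω, U ω)) (X ω, V ω, U ω) / law q U (U ω)) /
      ((law q (fun ω => (X ω, U ω)) (X ω, U ω) / law q U (U ω)) *
        (law q (fun ω => (V ω, U ω)) (V ω, U ω) / law q U (U ω)))) (fun ω h => ?_) hη)
  · refine prob_mono (iidMass_mem_stdSimplex n hq).1 fun x hx h => ?_
    have hp := fun j => pos_of_iidMass_pos hq.1 hx j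
    have h1 := Finset.prod_pos fun j (_ : j ∈ Finset.univ) => law_pos hq.1 U (hp j)
    have h2 := Finset.prod_pos fun j (_ : j ∈ Finset.univ) =>
      law_pos hq.1 (fun ω => (X ω, U ω)) (hp j)
    have h3 := Finset.prod_pos fun j (_ : j ∈ Finset.univ) =>
      law_pos hq.1 (fun ω => (V ω, U ω)) (hp j)
    rw [law_congr (iidMass n q) (X := fun x => (((fun j => X (x j)), fun j => U (x j)),
      fun j => V (x j))) (Y := fun x => ((fun j => X (x j)), (fun j => V (x j)),
      fun j => U (x j))) (b := ((fun j => X (x j)), (fun j => V (x j)), fun j => U (x j)))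
      fun ω => by simp only [Prod.mk.injEq]; tauto, law_iidMass_triple, law_iidMass_pair,
      law_iidMass_pair, law_iidMass_comp] at h
    simp only [Finset.prod_div_distrib, Finset.prod_mul_distrib]
    refine ((lt_div_iff₀ (mul_pos h2 h3)).mpr h).trans_eq ?_
    field_simp
  · exact div_pos (div_pos (law_pos hq.1 (fun ω => (X ω, V ω, U ω)) h) (law_pos hq.1 U h))
      (mul_pos (div_pos (law_pos hq.1 (fun ω => (X ω, U ω)) h) (law_pos hq.1 U h))
        (div_pos (law_pos hq.1 (fun ω => (V ω, U ω)) h) (law_pos hq.1 U h)))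

theorem tendsto_prob_condEntropy [Fintype A] [Fintype B] [Fintype C] {q : Ω → ℝ}
    (hq : q ∈ stdSimplex ℝ Ω) (Y : Ω → A) (U : Ω → B) (V : Ω → C) {η : ℝ} (hη : 0 < η) :
    Tendsto (fun n : ℕ => prob (iidMass n q) fun ω =>
      (2 : ℝ) ^ (n * (condEntropy q Y (fun ω => (U ω, V ω)) + η)) *
        law (iidMass n q) (fun x => ((fun j => Y (x j)), (fun j => U (x j)), fun j => V (x j)))
          ((fun j => Y (ω j)), (fun j => U (ω j)), fun j => V (ω j)) <
        law (iidMass n q) (fun x => ((fun j => U (x j)), fun j => V (x j)))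
          ((fun j => U (ω j)), fun j => V (ω j))) atTop (𝓝 0) := by
  rw [condEntropy_eq_sum]
  simp only [← Real.logb_inv, inv_div]
  refine squeeze_zero (fun n => prob_nonneg (iidMass_mem_stdSimplex n hq).1 _) (fun n => ?_)
    (tendsto_prob_prod_gt hq (F := fun ω => law q (fun ω => (U ω, V ω)) (U ω, V ω) /
      law q (fun ω => (Y ω, U ω, V ω)) (Y ω, U ω, V ω)) (fun ω h => ?_) hη)
  · refine prob_mono (iidMass_mem_stdSimplex n hq).1 fun x hx h => ?_
    have hp := fun j => pos_of_iidMass_pos hq.1 hx j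
    rw [law_iidMass_pair, law_iidMass_triple] at h
    rw [Finset.prod_div_distrib, lt_div_iff₀]
    · exact h
    · exact Finset.prod_pos fun j _ => law_pos hq.1 (fun ω => (Y ω, U ω, V ω)) (hp j)
  · exact div_pos (law_pos hq.1 (fun ω => (U ω, V ω)) h)
      (law_pos hq.1 (fun ω => (Y ω, U ω, V ω)) h)

/-- From `exp t ≥ 1 + t` at `t = M / Γ ≥ 1 / δ`. One condition of the form `Γ ≤ δ * M` thus serves
both covering and binning. -/
theorem exp_neg_div_le {M Γ δ : ℝ} (hΓ : 0 < Γ) (hδ : 0 < δ) (h : Γ ≤ δ * M) :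
    Real.exp (-(M / Γ)) ≤ δ := by
  have h1 : 1 / δ ≤ M / Γ := by
    rw [div_le_div_iff₀ hδ hΓ]; linarith
  have h2 := Real.add_one_le_exp (M / Γ)
  rw [Real.exp_neg, inv_le_comm₀ (Real.exp_pos _) hδ, ← one_div]
  linarith

/-- Index sets of rate at most `R + η` exceed `2 ^ (n (I + η / 2))` by any given factor. -/
theorem eventually_exists_index_size {I R η δ : ℝ} (hI : 0 ≤ I) (hR : I ≤ R) (hη : 0 < η)
    (hδ : 0 < δ) : ∀ᶠ n : ℕ in atTop, ∃ M : ℕ, 0 < M ∧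
      1 / (n : ℝ) * Real.logb 2 M ≤ R + η ∧ (2 : ℝ) ^ (n * (I + η / 2)) ≤ δ * M := by
  have hgrow : Tendsto (fun n : ℕ => (2 : ℝ) ^ (n * (η / 2))) atTop atTop :=
    (tendsto_rpow_atTop_of_base_gt_one 2 one_lt_two).comp
      (tendsto_natCast_atTop_atTop.atTop_mul_const (half_pos hη))
  filter_upwards [hgrow.eventually_ge_atTop (1 / δ + 1), eventually_gt_atTop 0] with n hn hn0
  have hn' : (0 : ℝ) < n := by exact_mod_cast hn0
  have h1 : (1 : ℝ) ≤ 2 ^ (n * (R + η)) :=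
    Real.one_le_rpow one_le_two (by have : 0 ≤ R + η := by linarith
                                    positivity)
  have h2 : (1 : ℝ) ≤ 2 ^ (n * (I + η / 2)) :=
    Real.one_le_rpow one_le_two (by positivity)
  have hM : 0 < ⌊(2 : ℝ) ^ (n * (R + η))⌋₊ := Nat.floor_pos.mpr h1
  refine ⟨⌊(2 : ℝ) ^ (n * (R + η))⌋₊, hM, ?_, ?_⟩
  · have h3 := Real.logb_le_logb_of_le one_lt_two (by exact_mod_cast hM)
      (Nat.floor_le (by positivity : (0 : ℝ) ≤ 2 ^ (n * (R + η))))
    rw [Real.logb_rpow two_pos (by norm_num)] at h3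
    rw [one_div, inv_mul_le_iff₀ hn']
    exact h3
  · have h4 := (Nat.lt_floor_add_one ((2 : ℝ) ^ (n * (R + η)))).le
    -- The extra `+ 1` pays for the floor, which loses at most `1 ≤ 2 ^ (n * (I + η / 2))`.
    have h5 : (2 : ℝ) ^ (n * (I + η / 2)) * (1 / δ + 1) ≤ 2 ^ (n * (R + η)) := by
      refine (mul_le_mul_of_nonneg_left hn (by positivity)).trans ?_
      rw [← Real.rpow_add two_pos]
      refine Real.rpow_le_rpow_of_exponent_le one_le_two ?_
      nlinarith
    have h6 : (2 : ℝ) ^ (n * (I + η / 2)) * (1 / δ) ≤ ⌊(2 : ℝ) ^ (n * (R + η))⌋₊ := by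
      linarith
    rw [mul_one_div, div_le_iff₀ hδ] at h6
    linarith

end Asymptotics

section Achievability

open Filter Topology

variable {𝒳₀ 𝒳₁ 𝒳₂ 𝒰₀ 𝒰₁ 𝒰₂ : Type*} [Fintype 𝒳₀] [Fintype 𝒳₁] [Fintype 𝒳₂]

theorem Code.errorProb_eq {n : ℕ} (c : Code n 𝒳₀ 𝒳₁ 𝒳₂) (p : 𝒳₀ × 𝒳₁ × 𝒳₂ → ℝ) :
    c.errorProb p = 1 / 2 * (prob (iidMass n p) (fun x => (fun i => (x i).2.1) ≠ c.est₁ x) +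
      prob (iidMass n p) fun x => (fun i => (x i).2.2) ≠ c.est₂ x) := by
  unfold Code.errorProb prob iidMass
  congr! 6

variable [Fintype 𝒰₀] [Fintype 𝒰₁] [Fintype 𝒰₂]

theorem IsAuxiliary.iidMass_eq {p : 𝒳₀ × 𝒳₁ × 𝒳₂ → ℝ}
    {q : (𝒳₀ × 𝒳₁ × 𝒳₂) × (𝒰₀ × 𝒰₁ × 𝒰₂) → ℝ} (h : IsAuxiliary p q) (n : ℕ) :
    iidMass n p = law (iidMass n q) fun x j => (x j).1 := by
  classical
  funext x
  rw [law_iidMass_comp n q Prod.fst]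
  refine Finset.prod_congr rfl fun j _ => ?_
  rw [← h.2.1 (x j), ← sum_law_pair_right q Prod.fst Prod.snd]
  exact Finset.sum_congr rfl fun u _ => (congrFun (law_id q) (x j, u)).symm

theorem IsAuxiliary.achievable {p : 𝒳₀ × 𝒳₁ × 𝒳₂ → ℝ}
    {q : (𝒳₀ × 𝒳₁ × 𝒳₂) × (𝒰₀ × 𝒰₁ × 𝒰₂) → ℝ} (h : IsAuxiliary p q) {R : Packet → ℝ}
    (hR : R ∈ infoRegion q) : Achievable p R := by
  intro η hη ε hε hε1
  have hq := h.1
  obtain ⟨h0, h1, h2, h3, h4⟩ := hR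
  -- With `δ = ε / 20` each sink errs with probability at most `10 * δ = ε / 2`, hence so does the
  -- average.
  have hδ : 0 < ε / 20 := by positivity
  have hδ3 : 0 < (ε / 20) ^ 3 := by positivity
  have hη2 : 0 < η / 2 := by positivity
  have hK₁ := h.2.2.1.comp_right fun u : 𝒰₀ × 𝒰₁ × 𝒰₂ => (u.1, u.2.1)
  have hK₂ := h.2.2.2.comp_right fun u : 𝒰₀ × 𝒰₁ × 𝒰₂ => (u.1, u.2.2)
  filter_upwards [
    eventually_exists_index_size (mutualInfo_nonneg hq _ _) h0 hη hδ,
    eventually_exists_index_size (condMutualInfo_nonneg hq _ _ _) h1 hη hδ,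
    eventually_exists_index_size (condMutualInfo_nonneg hq _ _ _) h2 hη hδ,
    eventually_exists_index_size (condEntropy_nonneg hq.1 _ _) h3 hη hδ,
    eventually_exists_index_size (condEntropy_nonneg hq.1 _ _) h4 hη hδ,
    (tendsto_prob_mutualInfo hq (fun ω => ω.1.1) (fun ω => ω.2.1) hη2).eventually_le_const hδ3,
    (tendsto_prob_condMutualInfo hq (fun ω => ω.1.1) (fun ω => ω.2.2.1) (fun ω => ω.2.1)
      hη2).eventually_le_const hδ3,
    (tendsto_prob_condMutualInfo hq (fun ω => ω.1.1) (fun ω => ω.2.2.2) (fun ω => ω.2.1)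
      hη2).eventually_le_const hδ3,
    (tendsto_prob_condEntropy hq (fun ω => ω.1.2.1) (fun ω => ω.2.1) (fun ω => ω.2.2.1)
      hη2).eventually_le_const hδ3,
    (tendsto_prob_condEntropy hq (fun ω => ω.1.2.2) (fun ω => ω.2.1) (fun ω => ω.2.2.2)
      hη2).eventually_le_const hδ3]
    with n ⟨M₀, hM₀, hM₀R, hM₀Γ⟩ ⟨M₁, hM₁, hM₁R, hM₁Γ⟩ ⟨M₂, hM₂, hM₂R, hM₂Γ⟩
      ⟨L₁, hL₁, hL₁R, hL₁N⟩ ⟨L₂, hL₂, hL₂R, hL₂N⟩ hX hV₁ hV₂ hY₁ hY₂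
  obtain ⟨φ₀, φ₁, φ₂, b₁, b₂, d₁, d₂, he₁, he₂⟩ := exists_oneShot_code
    (iidMass_mem_stdSimplex n hq) _ _ _ _ _ _ (hK₁.iid n) (hK₂.iid n)
    (by positivity) (by positivity) (by positivity) (by positivity) (by positivity) hδ
    (by linarith) hM₀ hM₁ hM₂ hL₁ hL₂ (exp_neg_div_le (by positivity) hδ hM₀Γ)
    (exp_neg_div_le (by positivity) hδ hM₁Γ) (exp_neg_div_le (by positivity) hδ hM₂Γ) hL₁N hL₂N
    hX hV₁ hV₂ hY₁ hY₂
  refine ⟨⟨fun | .p012 => M₀ | .p01 => M₁ | .p02 => M₂ | .p1 => L₁ | .p2 => L₂,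
    fun x => (φ₀ x, φ₁ x, φ₂ x), b₁, b₂, d₁, d₂⟩, ?_, ?_⟩
  · rintro (_ | _ | _ | _ | _) <;> assumption
  · rw [Code.errorProb_eq, h.iidMass_eq, prob_law, prob_law]
    simp only [Code.est₁, Code.est₂]
    linarith

end Achievability

/-! ### Entropies of block codes -/

section Block

variable {Ω A B C : Type*}

/-- The first `k` letters of the sequence `Z (x 0), Z (x 1), …`, padded with `none`. -/
def pre {n : ℕ} (Z : Ω → A) (k : ℕ) (x : Fin n → Ω) : Fin n → Option A :=
  fun j => if j.val < k then some (Z (x j)) else none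

theorem pre_eq_iff {n : ℕ} {Z : Ω → A} {k : ℕ} {x x' : Fin n → Ω} :
    pre Z k x = pre Z k x' ↔ ∀ j : Fin n, j.val < k → Z (x j) = Z (x' j) := by
  rw [funext_iff]
  refine forall_congr' fun j => ?_
  by_cases h : j.val < k <;> simp [pre, h]

theorem pre_succ_eq_iff {n : ℕ} {Z : Ω → A} {i : Fin n} {x x' : Fin n → Ω} :
    pre Z (i + 1) x = pre Z (i + 1) x' ↔ Z (x i) = Z (x' i) ∧ pre Z i x = pre Z i x' := by
  rw [pre_eq_iff, pre_eq_iff]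
  constructor
  · exact fun h => ⟨h i (Nat.lt_succ_self _), fun j hj => h j (Nat.lt_succ_of_lt hj)⟩
  · rintro ⟨h1, h2⟩ j hj
    rcases Nat.lt_succ_iff_lt_or_eq.mp hj with h | h
    · exact h2 j h
    · rw [Fin.ext h]; exact h1

variable [Fintype Ω]

/-- The chain rule along the letters of a block. -/
theorem sum_entropy_pre (n : ℕ) (q : (Fin n → Ω) → ℝ) (Z : Ω → A) (S : (Fin n → Ω) → C) :
    ∑ i : Fin n, (entropy q (fun x => (Z (x i), S x, pre Z i x)) -
      entropy q (fun x => (S x, pre Z i x))) =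
      entropy q (fun x => (S x, fun j => Z (x j))) - entropy q S := by
  have h1 : ∀ i : Fin n, entropy q (fun x => (Z (x i), S x, pre Z i x)) =
      entropy q (fun x => (S x, pre Z (i + 1) x)) := fun i =>
    entropy_congr q fun x x' => by
      simp only [Prod.mk.injEq, pre_succ_eq_iff]; tauto
  simp only [h1]
  rw [Fin.sum_univ_eq_sum_range (fun k => entropy q (fun x => (S x, pre Z (k + 1) x)) -
    entropy q (fun x => (S x, pre Z k x))) n,
    Finset.sum_range_sub fun k => entropy q (fun x => (S x, pre Z k x))]
  congr 1
  · exact entropy_congr q fun x x' => by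
      simp only [Prod.mk.injEq, pre_eq_iff, funext_iff (f := fun j => Z (x j)), Fin.is_lt,
        true_imp_iff]
  · exact entropy_congr q fun x x' => by simp [pre_eq_iff]

theorem law_iidMass_coord (n : ℕ) {p : Ω → ℝ} (hp : p ∈ stdSimplex ℝ Ω) (i : Fin n) :
    law (iidMass n p) (fun x => x i) = p := by
  classical
  funext ω
  rw [law_eq_prob, prob_eq_sum_mul, sum_iidMass_mul_coord n hp i fun ω' => if ω' = ω then 1 else 0]
  simp

/-- The summands are `I(Z_i; T, Z^{i-1})`. By independence and the chain rule they add up to `I(Zⁿ;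
T)`, which is `H(T)` because `T` is a function of `Zⁿ`. -/
theorem sum_mutualInfo_pre (n : ℕ) {p : Ω → ℝ} (hp : p ∈ stdSimplex ℝ Ω) (Z : Ω → A)
    (T : (Fin n → Ω) → C)
    (hT : ∀ x x', (∀ j, Z (x j) = Z (x' j)) → T x = T x') :
    ∑ i : Fin n, (entropy p Z + entropy (iidMass n p) (fun x => (T x, pre Z i x)) -
      entropy (iidMass n p) (fun x => (Z (x i), T x, pre Z i x))) = entropy (iidMass n p) T := by
  have h1 := sum_entropy_pre n (iidMass n p) Z T
  have h2 := entropy_iidMass n hp fun _ => Z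
  have h3 : entropy (iidMass n p) (fun x => (T x, fun j => Z (x j))) =
      entropy (iidMass n p) (fun x j => Z (x j)) := entropy_congr _ fun x x' => by
    simp only [Prod.mk.injEq, and_iff_right_iff_imp]
    exact fun h => hT x x' (congrFun h)
  rw [h3, h2] at h1
  simp only [Finset.sum_sub_distrib, Finset.sum_add_distrib] at h1 ⊢
  linarith

/-- The summands `I(Z_i; T' | T, Z^{i-1})` add up to `I(Zⁿ; T' | T) = H(T' | T) ≤ H(T')`. -/
theorem sum_condMutualInfo_pre {D : Type*} [Fintype C] [Fintype D] (n : ℕ) {p : Ω → ℝ}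
    (hp : p ∈ stdSimplex ℝ Ω) (Z : Ω → A) (T : (Fin n → Ω) → C) (T' : (Fin n → Ω) → D)
    (hT : ∀ x x', (∀ j, Z (x j) = Z (x' j)) → T' x = T' x') :
    ∑ i : Fin n, (entropy (iidMass n p) (fun x => (Z (x i), T x, pre Z i x)) +
      entropy (iidMass n p) (fun x => ((T' x, T x), pre Z i x)) -
      entropy (iidMass n p) (fun x => (Z (x i), (T' x, T x), pre Z i x)) -
      entropy (iidMass n p) (fun x => (T x, pre Z i x))) ≤ entropy (iidMass n p) T' := by
  have h1 := sum_entropy_pre n (iidMass n p) Z T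
  have h2 := sum_entropy_pre n (iidMass n p) Z fun x => (T' x, T x)
  have h3 : entropy (iidMass n p) (fun x => (T x, fun j => Z (x j))) =
      entropy (iidMass n p) (fun x => ((T' x, T x), fun j => Z (x j))) :=
    entropy_congr _ fun x x' => by
      simp only [Prod.mk.injEq]
      exact ⟨fun h => ⟨⟨hT x x' (congrFun h.2), h.1⟩, h.2⟩, fun h => ⟨h.1.2, h.2⟩⟩
  have h4 := entropy_pair_le (iidMass_mem_stdSimplex n hp) T' T
  simp only [Finset.sum_sub_distrib, Finset.sum_add_distrib] at h1 h2 ⊢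
  linarith

/-- Given the past of `Z` and a function `S` of the whole block of `Z`, the past of `Y` carries no
further information about the present letter of `Y`. -/
theorem condEntropy_pre_le [Fintype A] [Fintype B] [Fintype C] (n : ℕ) {p : Ω → ℝ}
    (hp : p ∈ stdSimplex ℝ Ω) (Z : Ω → A) (Y : Ω → B) (S : (Fin n → Ω) → C)
    (hS : ∀ x x', (∀ j, Z (x j) = Z (x' j)) → S x = S x') (i : Fin n) :
    entropy (iidMass n p) (fun x => (Y (x i), S x, pre Z i x)) -
        entropy (iidMass n p) (fun x => (S x, pre Z i x)) ≤
      entropy (iidMass n p) (fun x => (Y (x i), S x, pre Y i x)) -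
        entropy (iidMass n p) (fun x => (S x, pre Y i x)) := by
  have hQ := iidMass_mem_stdSimplex n hp
  set Q := iidMass n p
  -- Memorylessness: `H(Y^{i-1} | Z^{i-1}) = H(Y^{i-1} | Zⁿ, S, Y_i)`. As `S` is a function of `Zⁿ`,
  -- all four entropies split into sums over letters, compared one by one.
  have hiid : entropy Q (fun x => (pre Y i x, pre Z i x)) - entropy Q (fun x => pre Z i x) =
      entropy Q (fun x => (pre Y i x, (fun j => Z (x j)), S x, pre Z i x, Y (x i))) -
        entropy Q (fun x => ((fun j => Z (x j)), S x, pre Z i x, Y (x i))) := by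
    have e1 : entropy Q (fun x => (pre Y i x, pre Z i x)) = ∑ j : Fin n, entropy p
        fun ω => if j.val < i then some (Y ω, Z ω) else none := by
      rw [← entropy_iidMass n hp fun j ω => if j.val < i then some (Y ω, Z ω) else none]
      refine entropy_congr _ fun x x' => ?_
      simp only [Prod.mk.injEq, pre_eq_iff, ← forall_and]
      rw [funext_iff]
      refine forall_congr' fun j => ?_
      by_cases h : j.val < i <;> simp [h]
    have e2 : entropy Q (fun x => pre Z i x) = ∑ j : Fin n, entropy p
        fun ω => if j.val < i then some (Z ω) else none :=
      entropy_iidMass n hp fun j ω => if j.val < i then some (Z ω) else none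
    have e3 : entropy Q (fun x => (pre Y i x, (fun j => Z (x j)), S x, pre Z i x, Y (x i))) =
        ∑ j : Fin n, entropy p
          fun ω => (Z ω, if j.val < i ∨ j = i then some (Y ω) else none) := by
      rw [← entropy_iidMass n hp fun j ω => (Z ω, if j.val < i ∨ j = i then some (Y ω) else none)]
      refine entropy_congr _ fun x x' => ?_
      simp only [Prod.mk.injEq, pre_eq_iff]
      simp only [funext_iff, Prod.mk.injEq]
      constructor
      · rintro ⟨h1, h2, -, -, h5⟩ j
        refine ⟨h2 j, ?_⟩
        split_ifs with h
        · rcases h with h | rfl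
          · rw [h1 j h]
          · rw [h5]
        · rfl
      · intro h
        refine ⟨fun j hj => ?_, fun j => (h j).1, hS x x' fun j => (h j).1, fun j _ => (h j).1, ?_⟩
        · simpa [hj] using (h j).2
        · simpa using (h i).2
    have e4 : entropy Q (fun x => ((fun j => Z (x j)), S x, pre Z i x, Y (x i))) =
        ∑ j : Fin n, entropy p fun ω => (Z ω, if j = i then some (Y ω) else none) := by
      rw [← entropy_iidMass n hp fun j ω => (Z ω, if j = i then some (Y ω) else none)]
      refine entropy_congr _ fun x x' => ?_
      simp only [Prod.mk.injEq, pre_eq_iff]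
      simp only [funext_iff, Prod.mk.injEq]
      constructor
      · rintro ⟨h2, -, -, h5⟩ j
        refine ⟨h2 j, ?_⟩
        split_ifs with h
        · rw [h, h5]
        · rfl
      · intro h
        refine ⟨fun j => (h j).1, hS x x' fun j => (h j).1, fun j _ => (h j).1, ?_⟩
        simpa using (h i).2
    rw [e1, e2, e3, e4, ← Finset.sum_sub_distrib, ← Finset.sum_sub_distrib]
    refine Finset.sum_congr rfl fun j _ => ?_
    by_cases h : j.val < i
    · have hne : j ≠ i := fun h' => by simp [h'] at h
      simp only [h, hne, true_or, if_true, if_false]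
      congr 1
      · exact entropy_congr p fun x x' => by simp [and_comm]
      · exact entropy_congr p fun x x' => by simp
    · simp only [h, false_or, if_false, entropy_const hp, sub_self]
  -- `s1` and `s2` squeeze `H(Y^{i-1} | S, Z^{i-1})` and `H(Y^{i-1} | S, Z^{i-1}, Y_i)` between the
  -- two sides of `hiid`, so `Y^{i-1}` can be added to the conditioning of `Y_i` for free; `s3` then
  -- drops `Z^{i-1}`.
  have s1 := entropy_submodular hQ (fun x => pre Y i x) S (fun x => pre Z i x)
  have s2 := entropy_submodular hQ (fun x => pre Y i x) (fun x j => Z (x j))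
    (fun x => (S x, pre Z i x, Y (x i)))
  have s3 := entropy_submodular hQ (fun x => Y (x i)) (fun x => pre Z i x)
    (fun x => (S x, pre Y i x))
  have c1 : entropy Q (fun x => (pre Y i x, S x, pre Z i x, Y (x i))) =
      entropy Q (fun x => (Y (x i), pre Z i x, S x, pre Y i x)) :=
    entropy_congr _ fun x x' => by simp only [Prod.mk.injEq]; tauto
  have c2 : entropy Q (fun x => (S x, pre Z i x, Y (x i))) =
      entropy Q (fun x => (Y (x i), S x, pre Z i x)) :=
    entropy_congr _ fun x x' => by simp only [Prod.mk.injEq]; tauto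
  have c3 : entropy Q (fun x => (pre Y i x, S x, pre Z i x)) =
      entropy Q (fun x => (pre Z i x, S x, pre Y i x)) :=
    entropy_congr _ fun x x' => by simp only [Prod.mk.injEq]; tauto
  linarith

/-- The converse bound for the packet of a source that is decoded at a sink. -/
theorem sum_condEntropy_pre_le [Fintype A] [Fintype B] [Fintype C] (n : ℕ) {p : Ω → ℝ}
    (hp : p ∈ stdSimplex ℝ Ω) (Z : Ω → A) (Y : Ω → B) (S : (Fin n → Ω) → C)
    (hS : ∀ x x', (∀ j, Z (x j) = Z (x' j)) → S x = S x') {L : ℕ} (T : (Fin n → Ω) → Fin L)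
    (est : (Fin n → Ω) → Fin n → B)
    (hest : ∀ x x', S x = S x' → T x = T x' → est x = est x') :
    ∑ i : Fin n, (entropy (iidMass n p) (fun x => (Y (x i), S x, pre Z i x)) -
        entropy (iidMass n p) (fun x => (S x, pre Z i x))) ≤
      Real.logb 2 L + (1 + prob (iidMass n p) (fun x => (fun j => Y (x j)) ≠ est x) *
        (n * Real.logb 2 (Fintype.card B))) := by
  have hQ := iidMass_mem_stdSimplex n hp
  refine (Finset.sum_le_sum fun i _ => condEntropy_pre_le n hp Z Y S hS i).trans ?_
  rw [sum_entropy_pre]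
  set Q := iidMass n p
  -- The chain is `H(Yⁿ | S) ≤ H(T) + H(Yⁿ | S, T) ≤ log₂ L + H(Yⁿ | est)`, with Fano's inequality
  -- on blocks for the last term.
  have hfano := entropy_pair_sub_le_fano hQ (fun x j => Y (x j)) est
  rw [Fintype.card_fun, Fintype.card_fin, Nat.cast_pow, Real.logb_pow] at hfano
  have h1 := entropy_submodular hQ (fun x j => Y (x j)) (fun x => (S x, T x)) est
  have h2 := entropy_pair_le hQ S T
  have h3 := entropy_le_logb_card hQ T
  rw [Fintype.card_fin] at h3
  have h4 : entropy Q (fun x => (S x, fun j => Y (x j))) ≤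
      entropy Q (fun x => ((fun j => Y (x j)), (S x, T x), est x)) :=
    entropy_mono hQ.1 fun x x' h => by
      simp only [Prod.mk.injEq] at h ⊢
      exact ⟨h.2.1.1, h.1⟩
  have h5 : entropy Q (fun x => ((S x, T x), est x)) = entropy Q (fun x => (S x, T x)) :=
    entropy_congr _ fun x x' => by
      simp only [Prod.mk.injEq, and_iff_left_iff_imp]
      exact fun h => hest x x' h.1 h.2
  linarith

/-- A function of `x i` and a function of the block `X (x 0), X (x 1), …` are conditionally
independent given `X (x i)`. -/
theorem law_coord_mul_law [Fintype A] (n : ℕ) (p : Ω → ℝ) (X : Ω → A) (g : Ω → B) (i : Fin n) (s : (Fin n → A) → C) (b : B) (a : A) (c : C) :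
    law (iidMass n p) (fun x => (g (x i), X (x i), s fun j => X (x j))) (b, a, c) * law p X a =
      law p (fun ω => (g ω, X ω)) (b, a) *
        law (iidMass n p) (fun x => (X (x i), s fun j => X (x j))) (a, c) := by
  classical
  have h1 : law (iidMass n p) (fun x => (g (x i), X (x i), s fun j => X (x j))) (b, a, c) =
      ∑ z : Fin n → A, if (z i, s z) = (a, c) then
        law (iidMass n p) (fun x => (g (x i), fun j => X (x j))) (b, z) else 0 := by
    refine (law_pair_comp (iidMass n p) (fun x => g (x i)) (fun x j => X (x j))
      (fun z => (z i, s z)) b (a, c)).trans ?_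
    congr!
  have h2 : law (iidMass n p) (fun x => (X (x i), s fun j => X (x j))) (a, c) =
      ∑ z : Fin n → A, if (z i, s z) = (a, c) then
        law (iidMass n p) (fun x j => X (x j)) z else 0 := by
    rw [← law_law (iidMass n p) (fun x j => X (x j)) fun z : Fin n → A => (z i, s z)]
    unfold law
    congr!
  rw [h1, h2, Finset.sum_mul, Finset.mul_sum]
  refine Finset.sum_congr rfl fun z _ => ?_
  split_ifs with h
  · have hz : z i = a := (Prod.mk.inj h).1
    subst hz
    -- Attaching `g` to coordinate `i` only, and `none` elsewhere, makes the event a product over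
    -- the coordinates.
    have h3 : law (iidMass n p) (fun x => (g (x i), fun j => X (x j))) (b, z) =
        ∏ j, law p (fun ω => (X ω, if j = i then some (g ω) else none))
          (z j, if j = i then some b else none) := by
      rw [← law_iidMass n p (fun j ω => (X ω, if j = i then some (g ω) else none))
        fun j => (z j, if j = i then some b else none)]
      refine law_congr _ fun x => ?_
      simp only [Prod.mk.injEq, funext_iff]
      constructor
      · rintro ⟨h4, h5⟩ j
        refine ⟨h5 j, ?_⟩
        split_ifs with hj
        · rw [hj, h4]
        · rfl
      · intro h4
        exact ⟨by simpa using (h4 i).2, fun j => (h4 j).1⟩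
    rw [h3, law_iidMass n p (fun _ => X), Fintype.prod_eq_mul_prod_compl i,
      Fintype.prod_eq_mul_prod_compl i]
    have h6 : ∀ j ∈ ({i}ᶜ : Finset (Fin n)),
        law p (fun ω => (X ω, if j = i then some (g ω) else none))
          (z j, if j = i then some b else none) = law p X (z j) := by
      intro j hj
      have hne : j ≠ i := by simpa using hj
      exact law_congr p fun ω => by simp [hne]
    have h7 : law p (fun ω => (X ω, if i = i then some (g ω) else none))
        (z i, if i = i then some b else none) = law p (fun ω => (g ω, X ω)) (b, z i) :=
      law_congr p fun ω => by simp [and_comm]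
    rw [Finset.prod_congr rfl h6, h7]
    ring
  · simp

end Block

/-! ### Time sharing -/

section TimeSharing

variable {Ω A B C : Type*} [Fintype Ω]

/-- The joint law of a uniform time index and a block with mass function `Q`. -/
noncomputable def timeMass (n : ℕ) (Q : Ω → ℝ) (a : Fin n × Ω) : ℝ := (1 / (n : ℝ)) * Q a.2

theorem timeMass_mem_stdSimplex {n : ℕ} (hn : 0 < n) {Q : Ω → ℝ} (hQ : Q ∈ stdSimplex ℝ Ω) :
    timeMass n Q ∈ stdSimplex ℝ (Fin n × Ω) := by
  have hn' : (n : ℝ) ≠ 0 := by exact_mod_cast hn.ne'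
  refine ⟨fun a => mul_nonneg (by positivity) (hQ.1 _), ?_⟩
  simp only [timeMass, Fintype.sum_prod_type, ← Finset.mul_sum, hQ.2]
  simp [hn']

theorem law_timeMass_eq_average (n : ℕ) (Q : Ω → ℝ) (W : Fin n → Ω → A) (a : A) :
    law (timeMass n Q) (fun t => W t.1 t.2) a = (1 / (n : ℝ)) * ∑ i, law Q (W i) a := by
  classical
  simp only [law, Fintype.sum_prod_type, Finset.mul_sum, timeMass, mul_ite, mul_zero]

theorem law_timeMass_pair (n : ℕ) (Q : Ω → ℝ) (W : Fin n → Ω → A) (i : Fin n) (a : A) :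
    law (timeMass n Q) (fun t => (t.1, W t.1 t.2)) (i, a) = (1 / (n : ℝ)) * law Q (W i) a := by
  classical
  rw [law_timeMass_eq_average n Q (fun i x => (i, W i x)), Finset.sum_eq_single i]
  · congr 1
    exact law_congr Q fun x => by simp
  · intro j _ hj
    simp [law, hj]
  · simp

/-- The term `log₂ n` is the entropy of the time index; it cancels in the differences below. -/
theorem entropy_timeMass {n : ℕ} (hn : 0 < n) {Q : Ω → ℝ} (hQ : Q ∈ stdSimplex ℝ Ω)
    (W : Fin n → Ω → A) :
    entropy (timeMass n Q) (fun t => (t.1, W t.1 t.2)) =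
      Real.logb 2 n + (1 / (n : ℝ)) * ∑ i, entropy Q (W i) := by
  have hn' : (n : ℝ) ≠ 0 := by exact_mod_cast hn.ne'
  have h : ∀ i, ∑ x, Q x * Real.logb 2 (1 / (n : ℝ) * law Q (W i) (W i x)) =
      -Real.logb 2 n - entropy Q (W i) := by
    intro i
    rw [sum_mul_eq_sum_mul_of_pos hQ.1 (g := fun x =>
      -Real.logb 2 n + Real.logb 2 (law Q (W i) (W i x)))]
    · simp only [mul_add, Finset.sum_add_distrib, ← Finset.sum_mul, hQ.2, entropy]
      ring
    · intro x hx
      rw [Real.logb_mul (one_div_ne_zero hn') (law_pos hQ.1 (W i) hx).ne', one_div, Real.logb_inv]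
  unfold entropy
  simp only [law_timeMass_pair, Fintype.sum_prod_type]
  simp only [timeMass, mul_assoc, ← Finset.mul_sum, h]
  simp only [Finset.sum_sub_distrib, Finset.sum_const, Finset.card_univ, Fintype.card_fin,
    nsmul_eq_mul, entropy, Finset.sum_neg_distrib]
  field_simp
  ring

theorem law_timeMass_coord {n : ℕ} (hn : 0 < n) {p : Ω → ℝ} (hp : p ∈ stdSimplex ℝ Ω)
    (g : Ω → A) : law (timeMass n (iidMass n p)) (fun t => g (t.2 t.1)) = law p g := by
  have hn' : (n : ℝ) ≠ 0 := by exact_mod_cast hn.ne'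
  funext a
  rw [law_timeMass_eq_average n (iidMass n p) fun i x => g (x i)]
  have : ∀ i : Fin n, law (iidMass n p) (fun x => g (x i)) a = law p g a := fun i => by
    rw [← law_law (iidMass n p) (fun x => x i) g, law_iidMass_coord n hp]
  simp only [this, Finset.sum_const, Finset.card_univ, Fintype.card_fin, nsmul_eq_mul]
  field_simp

theorem entropy_timeMass_coord {n : ℕ} (hn : 0 < n) {p : Ω → ℝ} (hp : p ∈ stdSimplex ℝ Ω)
    (g : Ω → A) : entropy (timeMass n (iidMass n p)) (fun t => g (t.2 t.1)) = entropy p g := by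
  have h := law_timeMass_coord hn hp fun ω => ω
  rw [law_id] at h
  rw [← entropy_law (timeMass n (iidMass n p)) (fun t => t.2 t.1) g, h]

/-- The law of the sampled letter is the same at every time, so the identity of `law_coord_mul_law`
at time `i` only acquires a factor `1 / n` on both sides. -/
theorem isMarkovChain_timeMass [Fintype A] {n : ℕ} (hn : 0 < n) {p : Ω → ℝ}
    (hp : p ∈ stdSimplex ℝ Ω) (X : Ω → A) (g : Ω → B) (s : Fin n → (Fin n → A) → C) :
    IsMarkovChain (timeMass n (iidMass n p)) (fun t => g (t.2 t.1)) (fun t => X (t.2 t.1))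
      (fun t => (t.1, s t.1 fun j => X (t.2 j))) := by
  rintro b a ⟨i, c⟩
  rw [law_timeMass_coord hn hp X, law_timeMass_coord hn hp fun ω => (g ω, X ω),
    law_congr (timeMass n (iidMass n p))
      (X := fun t => (g (t.2 t.1), X (t.2 t.1), t.1, s t.1 fun j => X (t.2 j)))
      (Y := fun t => (t.1, (g (t.2 t.1), X (t.2 t.1), s t.1 fun j => X (t.2 j))))
      (b := (i, b, a, c)) fun t => by simp only [Prod.mk.injEq]; tauto,
    law_congr (timeMass n (iidMass n p))
      (X := fun t => (X (t.2 t.1), t.1, s t.1 fun j => X (t.2 j)))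
      (Y := fun t => (t.1, (X (t.2 t.1), s t.1 fun j => X (t.2 j))))
      (b := (i, a, c)) fun t => by simp only [Prod.mk.injEq]; tauto,
    law_timeMass_pair n (iidMass n p) fun i x => (g (x i), X (x i), s i fun j => X (x j)),
    law_timeMass_pair n (iidMass n p) fun i x => (X (x i), s i fun j => X (x j)),
    mul_assoc, law_coord_mul_law n p X g i (s i)]
  ring

theorem entropy_timeMass_of_iff {n : ℕ} (hn : 0 < n) {Q : Ω → ℝ} (hQ : Q ∈ stdSimplex ℝ Ω)
    (F : Fin n × Ω → A) (G : Fin n → Ω → B)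
    (h : ∀ t t', F t = F t' ↔ t.1 = t'.1 ∧ G t.1 t.2 = G t'.1 t'.2) :
    entropy (timeMass n Q) F = Real.logb 2 n + (1 / (n : ℝ)) * ∑ i, entropy Q (G i) := by
  rw [← entropy_timeMass hn hQ G]
  exact entropy_congr _ fun t t' => by simp only [h, Prod.mk.injEq]

/-- The left side is `I(X; U₀)` for `U₀ = (time, T, past)`. Stationarity makes the sampled letter
independent of the time index, so `I(X; U₀)` is the average of the terms in `sum_mutualInfo_pre`. -/
theorem mutualInfo_timeMass_le {n L : ℕ} (hn : 0 < n) {p : Ω → ℝ} (hp : p ∈ stdSimplex ℝ Ω)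
    (X : Ω → A) (Z : Ω → B) (hZ : ∀ ω ω', Z ω = Z ω' ↔ X ω = X ω') (T : (Fin n → Ω) → Fin L)
    (hT : ∀ x x', (∀ j, Z (x j) = Z (x' j)) → T x = T x') :
    entropy (timeMass n (iidMass n p)) (fun t => X (t.2 t.1)) +
      entropy (timeMass n (iidMass n p)) (fun t => (t.1, T t.2, pre Z t.1 t.2)) -
      entropy (timeMass n (iidMass n p)) (fun t => (X (t.2 t.1), t.1, T t.2, pre Z t.1 t.2)) ≤
    1 / (n : ℝ) * Real.logb 2 L := by
  have hQ := iidMass_mem_stdSimplex n hp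
  have hn' : (n : ℝ) ≠ 0 := by exact_mod_cast hn.ne'
  rw [entropy_timeMass_coord hn hp X, ← entropy_congr p hZ,
    entropy_timeMass_of_iff hn hQ (fun t => (t.1, T t.2, pre Z t.1 t.2))
      (fun i x => (T x, pre Z i x)) (fun t t' => by simp only [Prod.mk.injEq]),
    entropy_timeMass_of_iff hn hQ (fun t => (X (t.2 t.1), t.1, T t.2, pre Z t.1 t.2))
      (fun i x => (Z (x i), T x, pre Z i x))
      (fun t t' => by simp only [Prod.mk.injEq, hZ]; tauto)]
  have h1 := entropy_le_logb_card hQ T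
  rw [Fintype.card_fin] at h1
  have h2 := mul_le_mul_of_nonneg_left ((sum_mutualInfo_pre n hp Z T hT).le.trans h1)
    (by positivity : 0 ≤ 1 / (n : ℝ))
  simp only [Finset.sum_sub_distrib, Finset.sum_add_distrib, Finset.sum_const, Finset.card_univ,
    Fintype.card_fin, nsmul_eq_mul] at h2
  have h3 : 1 / (n : ℝ) * (n * entropy p Z) = entropy p Z := by field_simp
  linarith

theorem condMutualInfo_timeMass_le [Fintype C] {n L : ℕ} (hn : 0 < n) {p : Ω → ℝ}
    (hp : p ∈ stdSimplex ℝ Ω) (X : Ω → A) (Z : Ω → B) (hZ : ∀ ω ω', Z ω = Z ω' ↔ X ω = X ω')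
    (T : (Fin n → Ω) → C) (T' : (Fin n → Ω) → Fin L)
    (hT' : ∀ x x', (∀ j, Z (x j) = Z (x' j)) → T' x = T' x') :
    entropy (timeMass n (iidMass n p)) (fun t => (X (t.2 t.1), t.1, T t.2, pre Z t.1 t.2)) +
      entropy (timeMass n (iidMass n p)) (fun t => (T' t.2, t.1, T t.2, pre Z t.1 t.2)) -
      entropy (timeMass n (iidMass n p))
        (fun t => (X (t.2 t.1), T' t.2, t.1, T t.2, pre Z t.1 t.2)) -
      entropy (timeMass n (iidMass n p)) (fun t => (t.1, T t.2, pre Z t.1 t.2)) ≤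
    1 / (n : ℝ) * Real.logb 2 L := by
  have hQ := iidMass_mem_stdSimplex n hp
  rw [entropy_timeMass_of_iff hn hQ (fun t => (X (t.2 t.1), t.1, T t.2, pre Z t.1 t.2))
      (fun i x => (Z (x i), T x, pre Z i x))
      (fun t t' => by simp only [Prod.mk.injEq, hZ]; tauto),
    entropy_timeMass_of_iff hn hQ (fun t => (T' t.2, t.1, T t.2, pre Z t.1 t.2))
      (fun i x => ((T' x, T x), pre Z i x)) (fun t t' => by simp only [Prod.mk.injEq]; tauto),
    entropy_timeMass_of_iff hn hQ (fun t => (X (t.2 t.1), T' t.2, t.1, T t.2, pre Z t.1 t.2))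
      (fun i x => (Z (x i), (T' x, T x), pre Z i x))
      (fun t t' => by simp only [Prod.mk.injEq, hZ]; tauto),
    entropy_timeMass_of_iff hn hQ (fun t => (t.1, T t.2, pre Z t.1 t.2))
      (fun i x => (T x, pre Z i x)) (fun t t' => by simp only [Prod.mk.injEq])]
  have h1 := entropy_le_logb_card hQ T'
  rw [Fintype.card_fin] at h1
  have h2 := mul_le_mul_of_nonneg_left ((sum_condMutualInfo_pre n hp Z T T' hT').trans h1)
    (by positivity : 0 ≤ 1 / (n : ℝ))
  simp only [Finset.sum_sub_distrib, Finset.sum_add_distrib] at h2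
  linarith

theorem condEntropy_timeMass_le {D : Type*} [Fintype A] [Fintype B] [Fintype C] [Fintype D]
    {n L : ℕ} (hn : 0 < n) {p : Ω → ℝ} (hp : p ∈ stdSimplex ℝ Ω) (Z : Ω → A) (Y : Ω → B)
    (T : (Fin n → Ω) → C) (T' : (Fin n → Ω) → D)
    (hT : ∀ x x', (∀ j, Z (x j) = Z (x' j)) → T x = T x' ∧ T' x = T' x')
    (K : (Fin n → Ω) → Fin L) (est : (Fin n → Ω) → Fin n → B)
    (hest : ∀ x x', (T x, T' x) = (T x', T' x') → K x = K x' → est x = est x') :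
    entropy (timeMass n (iidMass n p))
        (fun t => (Y (t.2 t.1), (t.1, T t.2, pre Z t.1 t.2), T' t.2)) -
      entropy (timeMass n (iidMass n p)) (fun t => ((t.1, T t.2, pre Z t.1 t.2), T' t.2)) ≤
    1 / (n : ℝ) * (Real.logb 2 L +
      (1 + prob (iidMass n p) (fun x => (fun j => Y (x j)) ≠ est x) *
        (n * Real.logb 2 (Fintype.card B)))) := by
  have hQ := iidMass_mem_stdSimplex n hp
  rw [entropy_timeMass_of_iff hn hQ
      (fun t => (Y (t.2 t.1), (t.1, T t.2, pre Z t.1 t.2), T' t.2))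
      (fun i x => (Y (x i), (T x, T' x), pre Z i x))
      (fun t t' => by simp only [Prod.mk.injEq]; tauto),
    entropy_timeMass_of_iff hn hQ (fun t => ((t.1, T t.2, pre Z t.1 t.2), T' t.2))
      (fun i x => ((T x, T' x), pre Z i x)) (fun t t' => by simp only [Prod.mk.injEq]; tauto)]
  have h1 := mul_le_mul_of_nonneg_left (sum_condEntropy_pre_le n hp Z Y (fun x => (T x, T' x))
    (fun x x' h => by rw [(hT x x' h).1, (hT x x' h).2]) K est hest)
    (by positivity : 0 ≤ 1 / (n : ℝ))
  simp only [Finset.sum_sub_distrib] at h1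
  linarith

end TimeSharing

/-! ### Converse -/

section Converse

open Filter Topology

theorem IsMarkovChain.of_law {Ω S A B C : Type*} [Fintype Ω] [Fintype S] {μ : Ω → ℝ} {W : Ω → S}
    {f : S → A} {g : S → B} {h : S → C}
    (hM : IsMarkovChain μ (fun t => f (W t)) (fun t => g (W t)) fun t => h (W t)) :
    IsMarkovChain (law μ W) f g h := by
  intro x y z
  simp only [law_law]
  exact hM x y z

variable {𝒳₀ 𝒳₁ 𝒳₂ : Type*} [Fintype 𝒳₀] [Fintype 𝒳₁] [Fintype 𝒳₂]

/-- Every code yields auxiliary random variables whose information constraints are met by its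
rates, up to the terms from Fano's inequality. -/
theorem Code.exists_isAuxiliary {p : 𝒳₀ × 𝒳₁ × 𝒳₂ → ℝ} (hp : p ∈ stdSimplex ℝ (𝒳₀ × 𝒳₁ × 𝒳₂))
    {n : ℕ} (hn : 0 < n) (c : Code n 𝒳₀ 𝒳₁ 𝒳₂) :
    ∃ (𝒱₀ 𝒱₁ 𝒱₂ : Type) (_ : Fintype 𝒱₀) (_ : Fintype 𝒱₁) (_ : Fintype 𝒱₂)
      (q : (𝒳₀ × 𝒳₁ × 𝒳₂) × (𝒱₀ × 𝒱₁ × 𝒱₂) → ℝ), IsAuxiliary p q ∧ ∀ R : Packet → ℝ,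
        1 / (n : ℝ) * Real.logb 2 (c.L .p012) ≤ R .p012 →
        1 / (n : ℝ) * Real.logb 2 (c.L .p01) ≤ R .p01 →
        1 / (n : ℝ) * Real.logb 2 (c.L .p02) ≤ R .p02 →
        1 / (n : ℝ) * (Real.logb 2 (c.L .p1) + (1 +
          prob (iidMass n p) (fun x => (fun i => (x i).2.1) ≠ c.est₁ x) *
            (n * Real.logb 2 (Fintype.card 𝒳₁)))) ≤ R .p1 →
        1 / (n : ℝ) * (Real.logb 2 (c.L .p2) + (1 +
          prob (iidMass n p) (fun x => (fun i => (x i).2.2) ≠ c.est₂ x) *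
            (n * Real.logb 2 (Fintype.card 𝒳₂)))) ≤ R .p2 →
        R ∈ infoRegion q := by
  classical
  have hQ := iidMass_mem_stdSimplex n hp
  have hμ := timeMass_mem_stdSimplex hn hQ
  set Q := iidMass n p with hQdef
  set μ := timeMass n Q with hμdef
  -- The past of `X₀` enters the auxiliary alphabet, which must lie in `Type`, whereas `𝒳₀` may live
  -- in a higher universe; hence the recoding by `Fin`.
  let e := Fintype.equivFin 𝒳₀
  let Z : 𝒳₀ × 𝒳₁ × 𝒳₂ → Fin (Fintype.card 𝒳₀) := fun ω => e ω.1
  let T₀ : (Fin n → 𝒳₀ × 𝒳₁ × 𝒳₂) → Fin (c.L .p012) := fun x => (c.enc₀ fun j => (x j).1).1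
  let T₁ : (Fin n → 𝒳₀ × 𝒳₁ × 𝒳₂) → Fin (c.L .p01) := fun x => (c.enc₀ fun j => (x j).1).2.1
  let T₂ : (Fin n → 𝒳₀ × 𝒳₁ × 𝒳₂) → Fin (c.L .p02) := fun x => (c.enc₀ fun j => (x j).1).2.2
  have hZ : ∀ ω ω', Z ω = Z ω' ↔ ω.1 = ω'.1 := fun ω ω' => e.injective.eq_iff
  have hZfun : ∀ x x' : Fin n → 𝒳₀ × 𝒳₁ × 𝒳₂, (∀ j, Z (x j) = Z (x' j)) →
      (fun j => (x j).1) = fun j => (x' j).1 := fun x x' h => funext fun j => (hZ _ _).mp (h j)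
  have hT₀ : ∀ x x' : Fin n → 𝒳₀ × 𝒳₁ × 𝒳₂, (∀ j, Z (x j) = Z (x' j)) → T₀ x = T₀ x' :=
    fun x x' h => by simp only [T₀, hZfun x x' h]
  have hT₁ : ∀ x x' : Fin n → 𝒳₀ × 𝒳₁ × 𝒳₂, (∀ j, Z (x j) = Z (x' j)) → T₁ x = T₁ x' :=
    fun x x' h => by simp only [T₁, hZfun x x' h]
  have hT₂ : ∀ x x' : Fin n → 𝒳₀ × 𝒳₁ × 𝒳₂, (∀ j, Z (x j) = Z (x' j)) → T₂ x = T₂ x' :=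
    fun x x' h => by simp only [T₂, hZfun x x' h]
  -- The sampled letter together with `U₀ = (time, T₀, past of X₀)`, `U₁ = T₁`, `U₂ = T₂`.
  let W : Fin n × (Fin n → 𝒳₀ × 𝒳₁ × 𝒳₂) → (𝒳₀ × 𝒳₁ × 𝒳₂) ×
      ((Fin n × Fin (c.L .p012) × (Fin n → Option (Fin (Fintype.card 𝒳₀)))) ×
        Fin (c.L .p01) × Fin (c.L .p02)) :=
    fun t => (t.2 t.1, ((t.1, T₀ t.2, pre Z t.1 t.2), T₁ t.2, T₂ t.2))
  refine ⟨_, _, _, inferInstance, inferInstance, inferInstance, law μ W,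
    ⟨⟨law_nonneg hμ.1 W, by rw [sum_law, hμ.2]⟩, fun x => ?_, ?_, ?_⟩, ?_⟩
  · refine (sum_law_pair_right μ (fun t => t.2 t.1)
      (fun t => ((t.1, T₀ t.2, pre Z t.1 t.2), T₁ t.2, T₂ t.2)) x).trans ?_
    rw [hμdef, hQdef, law_timeMass_coord hn hp fun ω => ω, law_id]
  · apply IsMarkovChain.of_law
    exact (isMarkovChain_timeMass hn hp (fun ω => ω.1) (fun ω => ω.2.1) fun i z =>
      ((c.enc₀ z).1, pre e i z, (c.enc₀ z).2.1, (c.enc₀ z).2.2)).comp_right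
      fun v => ((v.1, v.2.1, v.2.2.1), v.2.2.2.1, v.2.2.2.2)
  · apply IsMarkovChain.of_law
    exact (isMarkovChain_timeMass hn hp (fun ω => ω.1) (fun ω => ω.2.2) fun i z =>
      ((c.enc₀ z).1, pre e i z, (c.enc₀ z).2.1, (c.enc₀ z).2.2)).comp_right
      fun v => ((v.1, v.2.1, v.2.2.1), v.2.2.2.1, v.2.2.2.2)
  have hlaw0 : ∀ a, 0 ≤ law μ W a := law_nonneg hμ.1 W
  intro R h0 h1 h2 h3 h4
  refine ⟨le_trans ?_ h0, le_trans ?_ h1, le_trans ?_ h2, le_trans ?_ h3, le_trans ?_ h4⟩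
  · rw [mutualInfo_eq hlaw0, entropy_law, entropy_law, entropy_law]
    exact mutualInfo_timeMass_le hn hp (fun ω => ω.1) Z hZ T₀ hT₀
  · rw [condMutualInfo_eq hlaw0, entropy_law, entropy_law, entropy_law, entropy_law]
    exact condMutualInfo_timeMass_le hn hp (fun ω => ω.1) Z hZ T₀ T₁ hT₁
  · rw [condMutualInfo_eq hlaw0, entropy_law, entropy_law, entropy_law, entropy_law]
    exact condMutualInfo_timeMass_le hn hp (fun ω => ω.1) Z hZ T₀ T₂ hT₂
  · rw [condEntropy_eq hlaw0, entropy_law, entropy_law]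
    refine condEntropy_timeMass_le hn hp Z (fun ω => ω.2.1) T₀ T₁
      (fun x x' h => ⟨hT₀ x x' h, hT₁ x x' h⟩) (fun x => c.enc₁ fun j => (x j).2.1) c.est₁ ?_
    intro x x' h h'
    obtain ⟨h5, h6⟩ := Prod.mk.inj h
    change c.dec₁ (T₀ x, T₁ x, _) = c.dec₁ (T₀ x', T₁ x', _)
    rw [h5, h6, h']
  · rw [condEntropy_eq hlaw0, entropy_law, entropy_law]
    refine condEntropy_timeMass_le hn hp Z (fun ω => ω.2.2) T₀ T₂
      (fun x x' h => ⟨hT₀ x x' h, hT₂ x x' h⟩) (fun x => c.enc₂ fun j => (x j).2.2) c.est₂ ?_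
    intro x x' h h'
    obtain ⟨h5, h6⟩ := Prod.mk.inj h
    change c.dec₂ (T₀ x, T₂ x, _) = c.dec₂ (T₀ x', T₂ x', _)
    rw [h5, h6, h']

theorem Achievable.add_const_mem_infoRegionUnion {p : 𝒳₀ × 𝒳₁ × 𝒳₂ → ℝ}
    (hp : p ∈ stdSimplex ℝ (𝒳₀ × 𝒳₁ × 𝒳₂)) {R : Packet → ℝ} (hR : Achievable p R) {δ : ℝ}
    (hδ : 0 < δ) : (fun k => R k + δ) ∈ infoRegionUnion p := by
  set b : ℝ := 1 + |Real.logb 2 (Fintype.card 𝒳₁)| + |Real.logb 2 (Fintype.card 𝒳₂)| with hb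
  have hb1 : 1 ≤ b := by
    have h1 := abs_nonneg (Real.logb 2 (Fintype.card 𝒳₁))
    have h2 := abs_nonneg (Real.logb 2 (Fintype.card 𝒳₂))
    linarith
  have hb0 : 0 < b := by linarith
  -- Each sink errs with probability at most `2 * ε`, since `errorProb` is an average. The slack `δ`
  -- is split into `δ / 2` for the rates, `δ / 4` for `1 / n` and `2 * ε * b ≤ δ / 4` for the Fano
  -- term.
  set ε : ℝ := min (1 / 2) (δ / (8 * b)) with hε
  have hε0 : 0 < ε := lt_min (by norm_num) (by positivity)
  have hεb : ε * b ≤ δ / 8 := by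
    have := min_le_right (1 / 2) (δ / (8 * b))
    calc ε * b ≤ δ / (8 * b) * b := mul_le_mul_of_nonneg_right this hb0.le
      _ = δ / 8 := by field_simp
  have hlarge : ∀ᶠ n : ℕ in atTop, 1 / (n : ℝ) ≤ δ / 4 :=
    (tendsto_const_div_atTop_nhds_zero_nat 1).eventually_le_const (by positivity)
  obtain ⟨n, ⟨⟨c, hc, herr⟩, hn1⟩, hn⟩ := (((hR (δ / 2) (by positivity) ε hε0
    ((min_le_left _ _).trans_lt (by norm_num))).and hlarge).and (eventually_gt_atTop 0)).exists
  have hn' : (0 : ℝ) < n := by exact_mod_cast hn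
  obtain ⟨V₀, V₁, V₂, i₀, i₁, i₂, q, hq, hmem⟩ := c.exists_isAuxiliary hp hn
  rw [Code.errorProb_eq] at herr
  have hQ := iidMass_mem_stdSimplex n hp
  have hP₁ := prob_nonneg hQ.1 fun x => (fun i => (x i).2.1) ≠ c.est₁ x
  have hP₂ := prob_nonneg hQ.1 fun x => (fun i => (x i).2.2) ≠ c.est₂ x
  have hfano : ∀ {P l r L : ℝ}, 0 ≤ P → P ≤ 2 * ε → l ≤ b → 1 / (n : ℝ) * L ≤ r + δ / 2 →
      1 / (n : ℝ) * (L + (1 + P * (n * l))) ≤ r + δ := by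
    intro P l r L h0 h1 h2 h3
    have h4 : 1 / (n : ℝ) * (L + (1 + P * (n * l))) =
        1 / (n : ℝ) * L + 1 / (n : ℝ) + P * l := by
      field_simp
      ring
    have h5 : P * l ≤ δ / 4 := by
      calc P * l ≤ P * b := mul_le_mul_of_nonneg_left h2 h0
        _ ≤ 2 * ε * b := mul_le_mul_of_nonneg_right h1 hb0.le
        _ ≤ δ / 4 := by linarith
    linarith
  have hl₁ : Real.logb 2 (Fintype.card 𝒳₁) ≤ b := by
    have h1 := le_abs_self (Real.logb 2 (Fintype.card 𝒳₁))
    have h2 := abs_nonneg (Real.logb 2 (Fintype.card 𝒳₂))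
    linarith
  have hl₂ : Real.logb 2 (Fintype.card 𝒳₂) ≤ b := by
    have h1 := abs_nonneg (Real.logb 2 (Fintype.card 𝒳₁))
    have h2 := le_abs_self (Real.logb 2 (Fintype.card 𝒳₂))
    linarith
  refine ⟨V₀, V₁, V₂, i₀, i₁, i₂, q, hq, hmem _ ?_ ?_ ?_ ?_ ?_⟩
  · linarith [hc .p012]
  · linarith [hc .p01]
  · linarith [hc .p02]
  · exact hfano hP₁ (by linarith) hl₁ (hc .p1)
  · exact hfano hP₂ (by linarith) hl₂ (hc .p2)

/-! ### Closedness of the rate region and the two inclusions -/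

/-- Half of the slack `η` absorbs the distance to a nearby achievable tuple, the other half is spent
on the code for that tuple. -/
theorem isClosed_rateRegion (p : 𝒳₀ × 𝒳₁ × 𝒳₂ → ℝ) : IsClosed (rateRegion p) := by
  rw [← closure_subset_iff_isClosed]
  intro R hR η hη ε hε hε1
  have hnear : ∀ᶠ R' in 𝓝 R, ∀ k, R' k < R k + η / 2 := by
    have h : ∀ k, ∀ᶠ R' : Packet → ℝ in 𝓝 R, R' k < R k + η / 2 := fun k =>
      (continuous_apply k).continuousAt.eventually_lt_const (by linarith)
    filter_upwards [h .p012, h .p01, h .p02, h .p1, h .p2] with R' h0 h1 h2 h3 h4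
    rintro (_ | _ | _ | _ | _) <;> assumption
  obtain ⟨R', hR', hlt⟩ := ((mem_closure_iff_frequently.mp hR).and_eventually hnear).exists
  filter_upwards [hR' (η / 2) (half_pos hη) ε hε hε1] with n ⟨c, hc, herr⟩
  exact ⟨c, fun k => (hc k).trans (by linarith [hlt k]), herr⟩

theorem rateRegion_eq_closure {p : 𝒳₀ × 𝒳₁ × 𝒳₂ → ℝ} (hp : p ∈ stdSimplex ℝ (𝒳₀ × 𝒳₁ × 𝒳₂)) :
    rateRegion p = closure (infoRegionUnion p) := by
  apply subset_antisymm
  · intro R hR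
    have hlim : Tendsto (fun δ : ℝ => fun k => R k + δ) (𝓝[>] 0) (𝓝 R) := by
      refine tendsto_pi_nhds.mpr fun k => ?_
      have h : Tendsto (fun δ : ℝ => R k + δ) (𝓝 0) (𝓝 (R k + 0)) :=
        (continuous_const.add continuous_id).tendsto 0
      rw [add_zero] at h
      exact h.mono_left nhdsWithin_le_nhds
    refine mem_closure_of_tendsto hlim ?_
    filter_upwards [self_mem_nhdsWithin] with δ hδ
    exact Achievable.add_const_mem_infoRegionUnion hp hR hδ
  · refine closure_minimal ?_ (isClosed_rateRegion p)
    rintro R ⟨V₀, V₁, V₂, i₀, i₁, i₂, q, hq, hR⟩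
    exact hq.achievable hR

end Converse

end HelperDIR

theorem theorem3 {𝒳₀ 𝒳₁ 𝒳₂ : Type*} [Fintype 𝒳₀] [Fintype 𝒳₁] [Fintype 𝒳₂]
    (p : 𝒳₀ × 𝒳₁ × 𝒳₂ → ℝ) (hp : p ∈ stdSimplex ℝ (𝒳₀ × 𝒳₁ × 𝒳₂)) :
    (∀ (𝒰₀ 𝒰₁ 𝒰₂ : Type*) [Fintype 𝒰₀] [Fintype 𝒰₁] [Fintype 𝒰₂]
        (q : (𝒳₀ × 𝒳₁ × 𝒳₂) × (𝒰₀ × 𝒰₁ × 𝒰₂) → ℝ), HelperDIR.IsAuxiliary p q →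
        ∀ R ∈ HelperDIR.infoRegion q, HelperDIR.Achievable p R) ∧
      HelperDIR.rateRegion p = closure (HelperDIR.infoRegionUnion p) :=
  ⟨fun _ _ _ _ _ _ _ hq _ hR => hq.achievable hR, HelperDIR.rateRegion_eq_closure hp⟩
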